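/- **Setting.** Let $\Gamma=\{0,\dots,L-1\}^D$ with the graph ($\ell_1$) distance, with a finite-dimensional system at each site. Let $H=\sum_{X\subseteq\Gamma}H_X$ be a geometrically local Hamiltonian: each $H_X$ is Hermitian, acts as the identity outside $X$, vanishes if $\operatorname{diam}X>1$, and $\|H_X\|\le 1$ (spectral norm). Each $H_X$ is given as a finite sum of Hermitian summands supported on $X$. For $Y\subseteq\Gamma$ let $H_Y$ be the sum of all summands supported in $Y$. Let $\mathcal U(t)(\rho)=e^{-iHt}\rho e^{iHt}$, and let $\|\Phi\|_\diamond=\sup_{\|\rho\|_1\le1}\|(\Phi\otimes 1)(\rho)\|_1$, with an ancilla of the dimension of the system. **Lieb-Robinson decomposition.** Fix $l\ge1$. Cutting a chain $[0,L)$ along disjoint, increasingly ordered overlaps $[p_j,q_j)$ ($1\le j\le n$), each with at least $l$ sites, replaces the evolution by the product of a forward evolution on $[0,q_1)$, a backward one on $[p_1,q_1)$, a forward one on $[p_1,q_2)$, ..., a backward one on $[p_n,q_n)$ and a forward one on $[p_n,L)$; this iterates $e^{-iHt}\approx e^{-iH_At}(e^{-iH_Yt})^\dagger e^{-iH_{Y\cup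 B}t}$, $Y\subseteq A$. In $D$ rounds, the $k$-th round cuts every block present along axis $k$ in this way (for a backward block one takes the inverse of the product; the overlaps may depend on the block). This gives an ordered list of $m$ blocks $Y_1,\dots,Y_m$ with signs $s_i=\pm1$. Let $\mathcal U_{Y_i}(t)$ be the channel of $e^{-is_iH_{Y_i}t}$. **Local composite channel.** For each block, partition the summands of $H_Y$ into an ordered Trotter family with norms $a_i$ and normalized terms $A_i$, and a QDrift family with norms $b_j$ and normalized terms $B_j$; let $\lambda_{B}=\sum_j b_j$ and let $N_{B}\ge1$ be a number of samples. With $\tau=s\,t$ for a block of sign $s$, $\mathcal X_Y(t)$ is the first-order Trotter channel, i.e. conjugation by $\prod_i e^{-ia_iA_i\tau}$, followed by $N_B$ applications of $\rho\mapsto\sum_j\frac{b_j}{\lambda_B}e^{-iB_j\lambda_B\tau/N_B}\rho\, e^{iB_j\lambda_B\tau/N_B}$ (the identity if $\lambda_B=0$). **Theorem.** For every $D$ there is $\mu>0$ such that for every $T$ there is $C>0$ (depending only on $D$ and $T$) such that, for all $L$, $l\ge1$, all local dimensions, Hamiltonians, decompositions and partitions as above, all $0\le t\le T$ and all $r\ge1$,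 with $$\epsilon_{LR}=\big\|\mathcal U_{Y_1}(t)\circ\cdots\circ\mathcal U_{Y_m}(t)-\mathcal U(t)\big\|_\diamond$$ one has $1\le m\le(2L/l+1)^D$ and $$\big\|\mathcal X_{Y_1}(t/r)^{\circ r}\circ\cdots\circ\mathcal X_{Y_m}(t/r)^{\circ r}-\mathcal U(t)\big\|_\diamond\le m\max_{Y}\big\|\mathcal X_Y(t/r)^{\circ r}-\mathcal U_Y(t)\big\|_\diamond+\epsilon_{LR}$$ $$\le m\max_Y\Big[\frac{t^2}{2r}\Big(\sum_{i,j}a_ia_j\|[A_i,A_j]\|+2\sum_{i,j}a_ib_j\|[A_i,B_j]\|\Big)+\frac{4\lambda_{B}^2t^2}{N_{B}\,r}\Big]+C e^{-\mu l}\frac{DL^D}{l},$$ where the maxima are over the $m$ blocks with their own families $A$, $B$, and moreover $\epsilon_{LR}\le C e^{-\mu l}DL^D/l$. -/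

import Mathlib

open scoped Matrix

noncomputable section

namespace LocalComposite

/-! ### Norms of operators and of linear maps on operators -/

section Norms

variable {n : Type*} [Fintype n] [DecidableEq n]

/-- The spectral norm (Schatten infinity norm): the operator norm on Euclidean space. -/
def opNorm (M : Matrix n n ℂ) : ℝ := ‖Matrix.toEuclideanCLM (n := n) (𝕜 := ℂ) M‖

/-- The trace norm (Schatten 1-norm): the sum of the singular values, that is, of the square
roots of the eigenvalues of `Mᴴ * M`. -/
def traceNorm (M : Matrix n n ℂ) : ℝ :=
  ∑ i, Real.sqrt ((Matrix.isHermitian_conjTranspose_mul_self M).eigenvalues i)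

/-- `Φ ⊗ id` applied to an operator `ρ` on the tensor product of the system and an ancilla of
the same dimension. -/
def ampliate (Φ : Module.End ℂ (Matrix n n ℂ)) (ρ : Matrix (n × n) (n × n) ℂ) :
    Matrix (n × n) (n × n) ℂ :=
  Matrix.of fun x y => Φ (Matrix.of fun i j => ρ (i, x.2) (j, y.2)) x.1 y.1

/-- The diamond norm `sup {‖(Φ ⊗ id) ρ‖₁ : ‖ρ‖₁ ≤ 1}`. -/
def diamondNorm (Φ : Module.End ℂ (Matrix n n ℂ)) : ℝ :=
  sSup {x : ℝ | ∃ ρ : Matrix (n × n) (n × n) ℂ, traceNorm ρ ≤ 1 ∧ x = traceNorm (ampliate Φ ρ)}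

/-- The operator `e^{-iHt}`. -/
def evolOp (H : Matrix n n ℂ) (t : ℝ) : Matrix n n ℂ :=
  NormedSpace.exp ((-(Complex.I * (t : ℂ))) • H)

/-- The map `ρ ↦ V ρ V†`. Composition of channels is the product of `Module.End`. -/
def conjChannel (V : Matrix n n ℂ) : Module.End ℂ (Matrix n n ℂ) :=
  LinearMap.mulLeft ℂ V * LinearMap.mulRight ℂ Vᴴ

/-- The exact evolution channel `ρ ↦ e^{-iHt} ρ e^{iHt}`. -/
def evolChannel (H : Matrix n n ℂ) (t : ℝ) : Module.End ℂ (Matrix n n ℂ) :=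
  conjChannel (evolOp H t)

end Norms

/-! ### Geometrically local Hamiltonians on the lattice `{0, …, L-1}^D` -/

/-- Lattice sites. -/
abbrev Site (D L : ℕ) : Type := Fin D → Fin L

/-- Product basis states of the lattice, with a `q`-level system at each site. -/
abbrev Config (D L q : ℕ) : Type := Site D L → Fin q

/-- Operators on the Hilbert space of the lattice. -/
abbrev Op (D L q : ℕ) : Type := Matrix (Config D L q) (Config D L q) ℂ

/-- Graph distance on the lattice. -/
def latticeDist {D L : ℕ} (x y : Site D L) : ℤ := ∑ k, |((x k : ℕ) : ℤ) - ((y k : ℕ) : ℤ)|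

/-- `M` is of the form `N ⊗ 1`, with `N` acting on the sites in `X`. -/
def SupportedOn {D L q : ℕ} (M : Op D L q) (X : Finset (Site D L)) : Prop :=
  ∃ N : Matrix (X → Fin q) (X → Fin q) ℂ, ∀ σ τ : Config D L q,
    M σ τ = if ∀ x, x ∉ X → σ x = τ x then N (fun x => σ x) (fun x => τ x) else 0

/-- A geometrically local Hamiltonian `∑_X H_X`, given through a finite list of summands. Each
`H_X` is the sum of the summands with support set `X`; it vanishes unless `diam X ≤ 1`, and
`‖H_X‖ ≤ 1`. -/
structure LocalHamiltonian (D L q : ℕ) where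
  numTerms : ℕ
  supp : Fin numTerms → Finset (Site D L)
  term : Fin numTerms → Op D L q
  isHermitian : ∀ j, (term j).IsHermitian
  supported : ∀ j, SupportedOn (term j) (supp j)
  diam_le : ∀ j, ∀ x ∈ supp j, ∀ y ∈ supp j, latticeDist x y ≤ 1
  norm_le : ∀ X : Finset (Site D L), opNorm (∑ j with supp j = X, term j) ≤ 1

namespace LocalHamiltonian

variable {D L q : ℕ} (H : LocalHamiltonian D L q)

/-- The sum `H_Y` of the terms supported in the region `Y`. -/
def onRegion (Y : Finset (Site D L)) : Op D L q := ∑ j with H.supp j ⊆ Y, H.term j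

/-- The whole Hamiltonian. -/
def total : Op D L q := ∑ j, H.term j

/-- The spectral norm `h_j` of the `j`-th summand. -/
def weight (j : Fin H.numTerms) : ℝ := opNorm (H.term j)

/-- The `j`-th summand divided by its spectral norm. -/
def unitTerm (j : Fin H.numTerms) : Op D L q := ((H.weight j : ℂ)⁻¹) • H.term j

end LocalHamiltonian

/-! ### The Lieb-Robinson block decomposition -/

/-- A box `{x : lo k ≤ x k < hi k for all k}`, evolved forwards or backwards in time. -/
structure Block (D : ℕ) where
  lo : Fin D → ℕ
  hi : Fin D → ℕ
  backward : Bool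

namespace Block

variable {D : ℕ}

/-- The lattice sites in the block. -/
def region (L : ℕ) (b : Block D) : Finset (Site D L) :=
  Finset.univ.filter fun x => ∀ k, b.lo k ≤ (x k : ℕ) ∧ (x k : ℕ) < b.hi k

/-- The direction of time in the block. -/
def sign (b : Block D) : ℝ := if b.backward then -1 else 1

/-- The whole lattice, evolved forwards. -/
def full (D L : ℕ) : Block D := ⟨fun _ => 0, fun _ => L, false⟩

/-- The box `b` with its `k`-th side replaced by `[s.1, s.2)`, and with time reversed if `back`. -/
def restrict (b : Block D) (k : Fin D) (s : ℕ × ℕ) (back : Bool) : Block D :=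
  ⟨Function.update b.lo k s.1, Function.update b.hi k s.2, xor b.backward back⟩

end Block

/-- `OverlapsOK L l 0 c`: the intervals `[p, q)` listed in `c` are overlaps for cutting the chain
`{0, …, L-1}`. They lie in it, are disjoint and in increasing order, and have at least `l` sites. -/
def OverlapsOK (L l : ℕ) : ℕ → List (ℕ × ℕ) → Prop
  | s, [] => s ≤ L
  | s, (p, q) :: c => s ≤ p ∧ p + l ≤ q ∧ OverlapsOK L l q c

/-- Iterates `e^{-iH t} ≈ e^{-iH_A t} (e^{-iH_Y t})† e^{-iH_{Y ∪ B} t}` on the chain `[s, L)`, where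
`A = [s, q)`, `Y = [p, q)` and `B = [q, L)`, the next cut being made in `Y ∪ B = [p, L)`. The result
lists the intervals of the factors from left to right, marking those evolved backwards. -/
def chainFactors (L : ℕ) : ℕ → List (ℕ × ℕ) → List ((ℕ × ℕ) × Bool)
  | s, [] => [((s, L), false)]
  | s, (p, q) :: c => ((s, q), false) :: ((p, q), true) :: chainFactors L p c

/-- Cuts a block along the axis `k`. The factors of an inverse evolution are the inverses of the
factors, in reverse order. -/
def Block.cut {D : ℕ} (L : ℕ) (b : Block D) (k : Fin D) (c : List (ℕ × ℕ)) : List (Block D) :=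
  let parts := (chainFactors L 0 c).map fun s => b.restrict k s.1 s.2
  if b.backward then parts.reverse else parts

/-- The blocks after `D` rounds, the `k`-th of which cuts every block `b` present at that stage
along the axis `k`, with overlaps `cuts k b`. -/
def lrBlocks {D : ℕ} (L : ℕ) (cuts : Fin D → Block D → List (ℕ × ℕ)) : List (Block D) :=
  (List.finRange D).foldl (fun bs k => bs.flatMap fun b => b.cut L k (cuts k b)) [Block.full D L]

/-! ### Local composite channels -/

/-- A partition of the summands of `H_Y` into a Trotter set `A` (an ordered list) and a QDrift
set `B`, together with the number of QDrift samples. -/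
structure Partition {D L q : ℕ} (H : LocalHamiltonian D L q) (Y : Finset (Site D L)) where
  trotter : List (Fin H.numTerms)
  qdrift : Finset (Fin H.numTerms)
  nodup : trotter.Nodup
  disjoint : ∀ j ∈ trotter, j ∉ qdrift
  mem_iff : ∀ j, (j ∈ trotter ∨ j ∈ qdrift) ↔ H.supp j ⊆ Y
  samples : ℕ
  samples_pos : 1 ≤ samples

namespace Partition

variable {D L q : ℕ} {H : LocalHamiltonian D L q} {Y : Finset (Site D L)} (P : Partition H Y)

/-- The sum `λ_B` of the spectral norms of the QDrift terms. -/
def lambda : ℝ := ∑ j ∈ P.qdrift, H.weight j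

/-- The first-order Trotter channel of the `A` terms. -/
def trotterChannel (t : ℝ) : Module.End ℂ (Op D L q) :=
  conjChannel (P.trotter.map fun j => evolOp (H.term j) t).prod

/-- The one-sample QDrift channel of the `B` terms: the normalized term `B_j` is drawn with
probability `b_j / λ_B` and evolved for the time `λ_B t`. It is the identity if all the `B` terms
vanish. -/
def qdriftChannel (t : ℝ) : Module.End ℂ (Op D L q) :=
  if P.lambda = 0 then 1
  else ∑ j ∈ P.qdrift, ((H.weight j / P.lambda : ℝ) : ℂ) •
    evolChannel (H.unitTerm j) (P.lambda * t)

/-- The composite channel: the Trotter channel, followed by `N_B` samples of QDrift. -/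
def compositeChannel (t : ℝ) : Module.End ℂ (Op D L q) :=
  P.qdriftChannel (t / P.samples) ^ P.samples * P.trotterChannel t

/-- `∑_{i,j} a_i a_j ‖[A_i, A_j]‖`, over all ordered pairs of Trotter terms. -/
def commAA : ℝ := ∑ i ∈ P.trotter.toFinset, ∑ j ∈ P.trotter.toFinset,
  H.weight i * H.weight j * opNorm ⁅H.unitTerm i, H.unitTerm j⁆

/-- `∑_{i,j} a_i b_j ‖[A_i, B_j]‖`, over Trotter terms `A_i` and QDrift terms `B_j`. -/
def commAB : ℝ := ∑ i ∈ P.trotter.toFinset, ∑ j ∈ P.qdrift,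
  H.weight i * H.weight j * opNorm ⁅H.unitTerm i, H.unitTerm j⁆

/-- The first-order composite error at time `t` with `r` iterations. -/
def errorBound (t : ℝ) (r : ℕ) : ℝ :=
  t ^ 2 / (2 * r) * (P.commAA + 2 * P.commAB) + 4 * P.lambda ^ 2 * t ^ 2 / (P.samples * r)

end Partition

end LocalComposite

end

open LocalComposite

namespace LocalComposite

/-! ### Exponentials of skew-adjoint elements: evolved observables, Trotter and splitting errors. -/

section SkewExp

variable {A : Type*} [CStarAlgebra A]

open NormedSpace

/-! All the maps involved are contractive for the bound `DiamondLE`, so errors of products and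
powers of channels simply add (`DiamondLE.mul_sub_mul`). The composite error therefore reduces to
the error on each block, and the remainder is the error of the exact block decomposition. Both are
estimated by differentiating in time and using that unitaries preserve the norm.

On one block, the derivative of $e^{-s(a+b)}e^{sa}e^{sb}$ is a commutator of size $O(s)$, which
gives the Trotter terms with the commutators $[A_i,A_j]$ and $[A_i,B_j]$. A QDrift step and the
exact evolution under $B$ agree to first order, because the sampled generators average to $B$; both
second-order remainders are at most $2(\lambda_B t)^2$. All these errors are quadratic in time, so
dividing the time into $r$ steps (or $N_B$ samples) gains a factor $r$ (or $N_B$), and the sign of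
time is irrelevant.

For the decomposition, consider a single cut with generators $z+y=a+w$. By `norm_exp_split_sub_le`
its error is governed by how much the evolutions of $w-y$ under $a$ and under $y$ differ. Terms of
$w-y$ away from the cut commute with both generators; the number of the others is proportional to
the cross-section of the slab. For each of these, $a$ and $y$ differ only beyond the overlap, and
the Lieb-Robinson bound `weight_mul_norm_heis_sub_le` makes the difference exponentially small in
the overlap. That bound comes from Grönwall's inequality in an exponentially weighted sup norm over
all local generators, with no series of nested commutators.

Finally the cuts are summed. A block of full length $L$ along the cut axis admits at most $L/l$
cuts, each costing its cross-section, hence the block costs at most its volume divided by $l$ times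
the unit error. One round multiplies the total volume by at most three, so $D$ rounds cost at most
$D\,3^D L^D/l$ times the unit error (`norm_prod_cutAlong_sub_le`). -/

theorem star_smul_of_skew {x : A} (hx : star x = -x) (t : ℝ) : star (t • x) = -(t • x) := by
  rw [star_smul, hx, smul_neg]; simp

theorem star_sum_of_skew {ι : Type*} {s : Finset ι} {g : ι → A} (hg : ∀ i, star (g i) = -g i) :
    star (∑ i ∈ s, g i) = -∑ i ∈ s, g i := by
  rw [star_sum, ← Finset.sum_neg_distrib]; exact Finset.sum_congr rfl fun i _ => hg i

theorem exp_mem_unitary_of_skew {x : A} (hx : star x = -x) : exp x ∈ unitary A := by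
  let +nondep : NormedAlgebra ℚ A := .restrictScalars ℚ ℂ A
  exact exp_mem_unitary_of_mem_skewAdjoint hx

theorem norm_le_one_of_mem_unitary {u : A} (hu : u ∈ unitary A) : ‖u‖ ≤ 1 := by
  nontriviality A
  exact (CStarRing.norm_of_mem_unitary hu).le

theorem exp_add_eq_mul {x y : A} (h : Commute x y) : exp (x + y) = exp x * exp y := by
  let +nondep : NormedAlgebra ℚ A := .restrictScalars ℚ ℂ A
  exact exp_add_of_commute h

theorem exp_neg_mul_exp (x : A) : exp (-x) * exp x = 1 := by
  rw [← exp_add_eq_mul ((Commute.refl x).neg_left), neg_add_cancel, exp_zero]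

theorem exp_mul_exp_neg (x : A) : exp x * exp (-x) = 1 := by
  rw [← exp_add_eq_mul ((Commute.refl x).neg_right), add_neg_cancel, exp_zero]

theorem star_exp_of_skew {x : A} (hx : star x = -x) : star (exp x) = exp (-x) := by
  rw [star_exp, hx]

theorem hasDerivAt_exp_smul (x : A) (t : ℝ) :
    HasDerivAt (fun s : ℝ => exp (s • x)) (exp (t • x) * x) t :=
  hasDerivAt_exp_smul_const x t

theorem hasDerivAt_exp_smul' (x : A) (t : ℝ) :
    HasDerivAt (fun s : ℝ => exp (s • x)) (x * exp (t • x)) t :=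
  hasDerivAt_exp_smul_const' x t

theorem hasDerivAt_exp_neg_smul (x : A) (t : ℝ) :
    HasDerivAt (fun s : ℝ => exp (-(s • x))) (-(exp (-(t • x)) * x)) t := by
  simpa only [smul_neg, mul_neg] using hasDerivAt_exp_smul_const (-x) t

/-- The evolution `e^{-ty} b e^{ty}` of the observable `b`. -/
noncomputable def heis (y : A) (t : ℝ) (b : A) : A := exp (-(t • y)) * b * exp (t • y)

theorem heis_zero_time (y b : A) : heis y 0 b = b := by simp [heis]

theorem heis_sub (y : A) (t : ℝ) (b c : A) : heis y t (b - c) = heis y t b - heis y t c := by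
  simp [heis, mul_sub, sub_mul]

theorem heis_sum {ι : Type*} (y : A) (t : ℝ) (s : Finset ι) (f : ι → A) :
    heis y t (∑ i ∈ s, f i) = ∑ i ∈ s, heis y t (f i) := by
  simp [heis, Finset.mul_sum, Finset.sum_mul]

theorem heis_mul (y : A) (t : ℝ) (b c : A) : heis y t (b * c) = heis y t b * heis y t c := by
  have h : exp (t • y) * exp (-(t • y)) = 1 := exp_mul_exp_neg _
  calc heis y t (b * c) = exp (-(t • y)) * b * 1 * c * exp (t • y) := by simp [heis, mul_assoc]
    _ = _ := by rw [← h]; simp only [heis, mul_assoc]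

theorem heis_of_commute {y b : A} (h : Commute b y) (t : ℝ) : heis y t b = b := by
  let +nondep : NormedAlgebra ℚ A := .restrictScalars ℚ ℂ A
  have h1 : Commute b (exp (t • y)) := (h.smul_right t).exp_right
  rw [heis, mul_assoc, h1.eq, ← mul_assoc, exp_neg_mul_exp, one_mul]

theorem norm_heis_le {y : A} (hy : star y = -y) (t : ℝ) (b : A) : ‖heis y t b‖ ≤ ‖b‖ := by
  have hu := exp_mem_unitary_of_skew (star_smul_of_skew hy t)
  have hv : exp (-(t • y)) ∈ unitary A :=
    exp_mem_unitary_of_skew (by rw [star_neg, star_smul_of_skew hy t])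
  rw [heis, CStarRing.norm_mul_mem_unitary _ hu, CStarRing.norm_mem_unitary_mul _ hv]

theorem hasDerivAt_heis (y b : A) (t : ℝ) :
    HasDerivAt (fun s => heis y s b) (heis y t (b * y - y * b)) t := by
  have h := ((hasDerivAt_exp_neg_smul y t).mul_const b).mul (hasDerivAt_exp_smul' y t)
  refine h.congr_deriv ?_
  simp only [heis, mul_sub, sub_mul, mul_assoc, neg_mul]
  abel

theorem norm_heis_sub_le {y : A} (hy : star y = -y) (b : A) {t : ℝ} (ht : 0 ≤ t) :
    ‖heis y t b - b‖ ≤ ‖b * y - y * b‖ * t := by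
  have := norm_image_sub_le_of_norm_deriv_le_segment' (a := 0) (b := t)
    (f := fun s => heis y s b) (fun s _ => (hasDerivAt_heis y b s).hasDerivWithinAt)
    (fun s _ => norm_heis_le hy s (b * y - y * b)) t ⟨ht, le_rfl⟩
  simpa [heis_zero_time] using this

theorem norm_exp_sub_one_le {x : A} (hx : star x = -x) {t : ℝ} (ht : 0 ≤ t) :
    ‖exp (t • x) - 1‖ ≤ ‖x‖ * t := by
  have := norm_image_sub_le_of_norm_deriv_le_segment' (a := 0) (b := t)
    (f := fun s : ℝ => exp (s • x)) (C := ‖x‖)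
    (fun s _ => (hasDerivAt_exp_smul x s).hasDerivWithinAt)
    (fun s _ => by
      rw [CStarRing.norm_mem_unitary_mul _ (exp_mem_unitary_of_skew (star_smul_of_skew hx s))])
    t ⟨ht, le_rfl⟩
  simpa using this

/-- Mean value inequality with the comparison function $ks^2/2$; it is the source of the factor 1/2
in the Trotter and Taylor estimates. -/
theorem norm_le_of_norm_deriv_le_linear {E : Type*} [NormedAddCommGroup E] [NormedSpace ℝ E]
    {f f' : ℝ → E} {k : ℝ} (hf : ∀ s, HasDerivAt f (f' s) s) (h0 : f 0 = 0)
    (hb : ∀ s, 0 ≤ s → ‖f' s‖ ≤ k * s) : ‖f 1‖ ≤ k / 2 := by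
  have := image_norm_le_of_norm_deriv_right_le_deriv_boundary (a := 0) (b := 1) (f := f)
    (f' := f') (B := fun s => k * (s ^ 2 / 2)) (B' := fun s => k * s)
    (fun s _ => (hf s).continuousAt.continuousWithinAt) (fun s _ => (hf s).hasDerivWithinAt)
    (by simp [h0])
    (fun s => by
      have h := (((hasDerivAt_id s).pow 2).div_const 2).const_mul k
      simpa using h)
    (fun s hs => hb s hs.1) (x := 1) ⟨zero_le_one, le_rfl⟩
  simpa [div_eq_mul_inv] using this

theorem norm_exp_sub_one_sub_le {x : A} (hx : star x = -x) :
    ‖exp x - 1 - x‖ ≤ ‖x‖ ^ 2 / 2 := by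
  have := norm_le_of_norm_deriv_le_linear (f := fun s : ℝ => exp (s • x) - 1 - s • x)
    (f' := fun s : ℝ => (exp (s • x) - 1) * x) (k := ‖x‖ ^ 2)
    (fun s => by
      have h := ((hasDerivAt_exp_smul x s).sub_const 1).sub ((hasDerivAt_id s).smul_const x)
      refine h.congr_deriv ?_
      simp [sub_mul])
    (by simp)
    (fun s hs => by
      refine (norm_mul_le _ _).trans ?_
      nlinarith [mul_le_mul_of_nonneg_right (norm_exp_sub_one_le hx hs) (norm_nonneg x)])
  simpa using this

theorem norm_exp_sub_one_le' {x : A} (hx : star x = -x) : ‖exp x - 1‖ ≤ ‖x‖ := by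
  simpa using norm_exp_sub_one_le hx zero_le_one

theorem norm_mul_le_of_unitary {u v : A} (hu : u ∈ unitary A) (hv : v ∈ unitary A) (x : A) :
    ‖u * x * v‖ = ‖x‖ := by
  rw [CStarRing.norm_mul_mem_unitary _ hv, CStarRing.norm_mem_unitary_mul _ hu]

theorem exp_mul_heis (y b : A) (t : ℝ) : exp (t • y) * heis y t b = b * exp (t • y) := by
  rw [heis, ← mul_assoc, ← mul_assoc, exp_mul_exp_neg, one_mul]

theorem heis_mul_exp_neg (y b : A) (t : ℝ) : heis y t b * exp (-(t • y)) = exp (-(t • y)) * b := by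
  rw [heis, mul_assoc, exp_mul_exp_neg, mul_one]

/-- First-order Trotter error for two factors. -/
theorem norm_exp_mul_exp_sub_le {a b : A} (ha : star a = -a) (hb : star b = -b) :
    ‖exp a * exp b - exp (a + b)‖ ≤ ‖a * b - b * a‖ / 2 := by
  have hab : star (a + b) = -(a + b) := by rw [star_add, ha, hb]; abel
  -- In the interaction picture the derivative is `b - heis a s b` placed between unitaries, and
  -- this is at most $s\|[a,b]\|$.
  have key := norm_le_of_norm_deriv_le_linear
    (f := fun s : ℝ => exp (-(s • (a + b))) * (exp (s • a) * exp (s • b)) - 1)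
    (f' := fun s : ℝ => exp (-(s • (a + b))) * (exp (s • a) * (b - heis a s b) * exp (s • b)))
    (k := ‖a * b - b * a‖) ?_ (by simp) ?_
  · have h1 : exp a * exp b - exp (a + b)
        = exp (a + b) * (exp (-(a + b)) * (exp a * exp b) - 1) := by
      rw [mul_sub, ← mul_assoc (exp (a + b)), exp_mul_exp_neg, one_mul, mul_one]
    rw [h1, CStarRing.norm_mem_unitary_mul _ (exp_mem_unitary_of_skew hab)]
    simpa using key
  · intro s
    have h := ((hasDerivAt_exp_neg_smul (a + b) s).mul
      ((hasDerivAt_exp_smul' a s).mul (hasDerivAt_exp_smul' b s))).sub_const 1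
    refine h.congr_deriv ?_
    rw [mul_sub (exp (s • a)), exp_mul_heis]
    simp only [Pi.mul_apply, mul_add, add_mul, sub_mul, mul_sub, mul_assoc, neg_mul, neg_add]
    abel
  · intro s hs
    have hu : exp (-(s • (a + b))) ∈ unitary A :=
      exp_mem_unitary_of_skew (by rw [star_neg, star_smul_of_skew hab])
    rw [CStarRing.norm_mem_unitary_mul _ hu, norm_mul_le_of_unitary
      (exp_mem_unitary_of_skew (star_smul_of_skew ha s))
      (exp_mem_unitary_of_skew (star_smul_of_skew hb s)), norm_sub_rev,
      norm_sub_rev (a * b)]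
    exact norm_heis_sub_le ha b hs

/-- First-order Trotter error for a list of factors. -/
theorem norm_prod_exp_sub_le {ι : Type*} [DecidableEq ι] (g : ι → A) (hg : ∀ i, star (g i) = -g i)
    (κ : ι → ι → ℝ) (hκ : ∀ i j, κ i j = κ j i) (hκ0 : ∀ i, 0 ≤ κ i i)
    (hgκ : ∀ i j, ‖g i * g j - g j * g i‖ ≤ κ i j) (c : List ι) (hc : c.Nodup) :
    ‖(c.map fun i => exp (g i)).prod - exp (∑ i ∈ c.toFinset, g i)‖
      ≤ (∑ i ∈ c.toFinset, ∑ j ∈ c.toFinset, κ i j) / 4 := by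
  induction c with
  | nil => simp
  | cons a c ih =>
    rw [List.nodup_cons] at hc
    have ha : a ∉ c.toFinset := by simpa using hc.1
    have hs := star_sum_of_skew (s := c.toFinset) hg
    rw [List.map_cons, List.prod_cons, List.toFinset_cons, Finset.sum_insert ha,
      Finset.sum_insert ha, Finset.sum_insert ha]
    simp_rw [Finset.sum_insert ha]
    rw [Finset.sum_add_distrib]
    simp_rw [fun i => hκ i a]
    -- Splitting off the head costs half of its commutators with the tail. The full double sum
    -- counts each such pair twice, whence the factor 1/4; the nonnegative diagonal term is dropped.
    have h1 := norm_exp_mul_exp_sub_le (hg a) hs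
    have h2 : ‖g a * ∑ i ∈ c.toFinset, g i - (∑ i ∈ c.toFinset, g i) * g a‖
        ≤ ∑ i ∈ c.toFinset, κ a i := by
      rw [Finset.mul_sum, Finset.sum_mul, ← Finset.sum_sub_distrib]
      exact norm_sum_le_of_le _ fun i _ => hgκ a i
    have h3 : ‖exp (g a) * (c.map fun i => exp (g i)).prod
        - exp (g a) * exp (∑ i ∈ c.toFinset, g i)‖
        ≤ (∑ i ∈ c.toFinset, ∑ j ∈ c.toFinset, κ i j) / 4 := by
      rw [← mul_sub, CStarRing.norm_mem_unitary_mul _ (exp_mem_unitary_of_skew (hg a))]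
      exact ih hc.2
    have h4 := norm_sub_le_norm_sub_add_norm_sub (exp (g a) * (c.map fun i => exp (g i)).prod)
      (exp (g a) * exp (∑ i ∈ c.toFinset, g i)) (exp (g a + ∑ i ∈ c.toFinset, g i))
    linarith [hκ0 a]

/-- The error of the split `e^z ≈ e^a e^{-y} e^w` of an evolution, `z + y = a + w`. -/
theorem norm_exp_split_sub_le {a y w z : A} (ha : star a = -a) (hy : star y = -y)
    (hw : star w = -w) (hz : z + y = a + w) {t k : ℝ} (ht : 0 ≤ t)
    (hk : ∀ s, 0 ≤ s → s ≤ t → ‖heis a s (w - y) - heis y s (w - y)‖ ≤ k) :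
    ‖exp (t • a) * (exp (-(t • y)) * exp (t • w)) - exp (t • z)‖ ≤ k * t := by
  obtain rfl : z = a + w - y := eq_sub_of_add_eq hz
  have hz' : star (a + w - y) = -(a + w - y) := by rw [star_sub, star_add, ha, hy, hw]; abel
  have hneg : ∀ {x : A} (_ : star x = -x) (s : ℝ), exp (-(s • x)) ∈ unitary A := fun {x} hx s =>
    exp_mem_unitary_of_skew (by rw [star_neg, star_smul_of_skew hx])
  have hpos : ∀ {x : A} (_ : star x = -x) (s : ℝ), exp (s • x) ∈ unitary A := fun {x} hx s =>
    exp_mem_unitary_of_skew (star_smul_of_skew hx s)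
  -- In the derivative, $-z+a=-(w-y)$ is moved to the right past $e^{sa}$ and $-y+w$ to the left
  -- past $e^{-sy}$. Each becomes an evolved copy of $w-y$ at the same place in the product, so that
  -- only their difference remains.
  have key := norm_image_sub_le_of_norm_deriv_le_segment' (a := 0) (b := t) (C := k)
    (f := fun s : ℝ => exp (-(s • (a + w - y))) *
      (exp (s • a) * (exp (-(s • y)) * exp (s • w))))
    (f' := fun s : ℝ => exp (-(s • (a + w - y))) *
      (exp (s • a) * (heis y s (w - y) - heis a s (w - y)) * (exp (-(s • y)) * exp (s • w))))
    (fun s _ => ?_) (fun s hs => ?_) t ⟨ht, le_rfl⟩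
  · have h1 : exp (t • a) * (exp (-(t • y)) * exp (t • w)) - exp (t • (a + w - y))
        = exp (t • (a + w - y)) * (exp (-(t • (a + w - y))) *
          (exp (t • a) * (exp (-(t • y)) * exp (t • w))) - 1) := by
      rw [mul_sub, ← mul_assoc (exp (t • (a + w - y))), exp_mul_exp_neg, one_mul, mul_one]
    rw [h1, CStarRing.norm_mem_unitary_mul _ (hpos hz' t)]
    simpa using key
  · have h := (hasDerivAt_exp_neg_smul (a + w - y) s).mul ((hasDerivAt_exp_smul' a s).mul
      ((hasDerivAt_exp_neg_smul y s).mul (hasDerivAt_exp_smul' w s)))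
    refine (h.congr_deriv ?_).hasDerivWithinAt
    have e : (heis y s (w - y) - heis a s (w - y)) * (exp (-(s • y)) * exp (s • w))
        = exp (-(s • y)) * (w - y) * exp (s • w)
          - heis a s (w - y) * (exp (-(s • y)) * exp (s • w)) := by
      rw [sub_mul, ← mul_assoc, heis_mul_exp_neg]
    rw [mul_assoc (exp (s • a)), e, mul_sub (exp (s • a)), ← mul_assoc (exp (s • a)) (heis _ _ _),
      exp_mul_heis]
    simp only [Pi.mul_apply, mul_add, add_mul, sub_mul, mul_sub, mul_assoc, neg_mul, mul_neg]
    abel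
  · rw [CStarRing.norm_mem_unitary_mul _ (hneg hz' s), norm_mul_le_of_unitary (hpos ha s)
      (mul_mem (hneg hy s) (hpos hw s)), norm_sub_rev]
    exact hk s hs.1 hs.2.le

end SkewExp

/-! ### A Lieb-Robinson bound by Grönwall's inequality. -/

section LiebRobinson

variable {A ι : Type*} [CStarAlgebra A]

theorem norm_commutator_sub_le {a b c d : A} (hb : ‖b‖ ≤ 1)
    (hc : ‖c‖ ≤ 1) :
    ‖(a * b - b * a) - (c * d - d * c)‖ ≤ 2 * ‖a - c‖ + 2 * ‖b - d‖ := by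
  have e : (a * b - b * a) - (c * d - d * c)
      = ((a - c) * b - b * (a - c)) + (c * (b - d) - (b - d) * c) := by noncomm_ring
  rw [e]
  have h1 : ‖(a - c) * b‖ ≤ ‖a - c‖ * 1 := norm_mul_le_of_le le_rfl hb
  have h2 : ‖b * (a - c)‖ ≤ 1 * ‖a - c‖ := norm_mul_le_of_le hb le_rfl
  have h3 : ‖c * (b - d)‖ ≤ 1 * ‖b - d‖ := norm_mul_le_of_le hc le_rfl
  have h4 : ‖(b - d) * c‖ ≤ ‖b - d‖ * 1 := norm_mul_le_of_le le_rfl hc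
  have h5 := norm_add_le ((a - c) * b - b * (a - c)) (c * (b - d) - (b - d) * c)
  have h6 := norm_sub_le ((a - c) * b) (b * (a - c))
  have h7 := norm_sub_le (c * (b - d)) ((b - d) * c)
  linarith

theorem norm_commutator_le {a b : A} (ha : ‖a‖ ≤ 1) (hb : ‖b‖ ≤ 1) : ‖a * b - b * a‖ ≤ 2 := by
  have h1 : ‖a * b‖ ≤ 1 * 1 := norm_mul_le_of_le ha hb
  have h2 : ‖b * a‖ ≤ 1 * 1 := norm_mul_le_of_le hb ha
  linarith [norm_sub_le (a * b) (b * a)]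

/-- The local generators `g i` with `i ∈ S` that do not commute with `g i` determine the derivative
of its evolution. -/
theorem hasDerivAt_heis_sum (g : ι → A) (adj : ι → ι → Prop) [DecidableRel adj]
    (hcomm : ∀ i j, ¬adj i j → Commute (g i) (g j)) (S : Finset ι) (i : ι) (t : ℝ) :
    HasDerivAt (fun s => heis (∑ j ∈ S, g j) s (g i))
      (∑ j ∈ S with adj i j, (heis (∑ j ∈ S, g j) t (g i) * heis (∑ j ∈ S, g j) t (g j)
        - heis (∑ j ∈ S, g j) t (g j) * heis (∑ j ∈ S, g j) t (g i))) t := by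
  refine (hasDerivAt_heis _ _ t).congr_deriv ?_
  simp only [← heis_mul, ← heis_sub]
  rw [← heis_sum, Finset.mul_sum, Finset.sum_mul, ← Finset.sum_sub_distrib, Finset.sum_filter]
  congr 1
  refine Finset.sum_congr rfl fun j _ => ?_
  split_ifs with h
  · rfl
  · rw [(hcomm i j h).eq, sub_self]

/-- A Lieb-Robinson bound: the evolutions of a local observable under the generators in `S` and in
`R ⊆ S` stay close if all generators near those in `S \ R` have a small weight. -/
theorem weight_mul_norm_heis_sub_le [Fintype ι] [DecidableEq ι] (g : ι → A)
    (hskew : ∀ i, star (g i) = -g i) (hg : ∀ i, ‖g i‖ ≤ 1) (adj : ι → ι → Prop) [DecidableRel adj]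
    (hcomm : ∀ i j, ¬adj i j → Commute (g i) (g j)) {c : ℕ} (hc1 : 1 ≤ c)
    (hc : ∀ i, (Finset.univ.filter (adj i)).card ≤ c) {S R : Finset ι} (hRS : R ⊆ S)
    {w : ι → ℝ} (hw0 : ∀ i, 0 ≤ w i) {E W : ℝ} (hE : 0 ≤ E) (hW : 0 ≤ W)
    (hw : ∀ i j, adj i j → w i ≤ E * w j)
    (hclose : ∀ i, ∀ j ∈ S, j ∉ R → adj i j → w i ≤ W) {t : ℝ} (ht : 0 ≤ t) (i : ι) :
    w i * ‖heis (∑ j ∈ S, g j) t (g i) - heis (∑ j ∈ R, g j) t (g i)‖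
      ≤ W * Real.exp (c * (2 + 2 * E) * t) := by
  set x : ℝ → ι → A := fun s i => heis (∑ j ∈ S, g j) s (g i) with hx
  set y : ℝ → ι → A := fun s i => heis (∑ j ∈ R, g j) s (g i) with hy
  have hx1 : ∀ s i, ‖x s i‖ ≤ 1 := fun s i =>
    (norm_heis_le (star_sum_of_skew hskew) s _).trans (hg i)
  have hy1 : ∀ s i, ‖y s i‖ ≤ 1 := fun s i =>
    (norm_heis_le (star_sum_of_skew hskew) s _).trans (hg i)
  have hcR : (0 : ℝ) < c := by exact_mod_cast hc1
  set K : ℝ := c * (2 + 2 * E) with hK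
  have hK0 : 0 < K := by positivity
  -- The weighted differences of all evolved generators form one curve in the sup norm. The system
  -- is closed: the derivative of an evolved generator involves only commutators of evolved
  -- generators.
  set F : ℝ → ι → A := fun s i => w i • (x s i - y s i) with hF
  set F' : ℝ → ι → A := fun s i => w i •
    ((∑ j ∈ S with adj i j, (x s i * x s j - x s j * x s i))
      - ∑ j ∈ R with adj i j, (y s i * y s j - y s j * y s i)) with hF'
  have hFF' : ∀ s, HasDerivAt F (F' s) s := fun s => hasDerivAt_pi.2 fun i =>
    ((hasDerivAt_heis_sum g adj hcomm S i s).sub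
      (hasDerivAt_heis_sum g adj hcomm R i s)).const_smul (w i)
  have hbound : ∀ s, ‖F' s‖ ≤ K * ‖F s‖ + 2 * c * W := by
    intro s
    refine (pi_norm_le_iff_of_nonneg (by positivity)).2 fun i => ?_
    -- Neighbours in `R` give differences of commutators, controlled by `‖F s‖` because the weight
    -- changes by a factor at most `E` between neighbours. Neighbours in `S \ R` give whole
    -- commutators of norm at most 2, but only where `w i ≤ W`; they are the source term `2 * c *
    -- W`.
    have hsplit : ∀ u v : ι → A, (∑ j ∈ S with adj i j, u j) - ∑ j ∈ R with adj i j, v j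
        = (∑ j ∈ (S \ R) with adj i j, u j) + ∑ j ∈ R with adj i j, (u j - v j) := fun u v => by
      rw [Finset.sum_sub_distrib, Finset.sum_filter (s := S), ← Finset.sum_sdiff hRS,
        ← Finset.sum_filter, ← Finset.sum_filter]
      abel
    have hcard : ∀ T : Finset ι, ((T.filter (adj i)).card : ℝ) ≤ c := fun T => by
      exact_mod_cast (Finset.card_le_card
        (Finset.filter_subset_filter _ (Finset.subset_univ T))).trans (hc i)
    have hFi : ∀ j, w j * ‖x s j - y s j‖ ≤ ‖F s‖ := fun j => by
      have := norm_le_pi_norm (F s) j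
      rwa [hF, norm_smul, Real.norm_of_nonneg (hw0 j)] at this
    rw [hF', norm_smul, Real.norm_of_nonneg (hw0 i), hsplit]
    refine (mul_le_mul_of_nonneg_left (norm_add_le _ _) (hw0 i)).trans ?_
    rw [mul_add, add_comm]
    refine add_le_add ?_ ?_
    · refine (mul_le_mul_of_nonneg_left (norm_sum_le _ _) (hw0 i)).trans ?_
      rw [Finset.mul_sum]
      refine (Finset.sum_le_card_nsmul _ _ ((2 + 2 * E) * ‖F s‖) fun j hj => ?_).trans ?_
      · have h1 := norm_commutator_sub_le (a := x s i) (d := y s j) (hx1 s j) (hy1 s i)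
        have h2 := mul_le_mul_of_nonneg_left h1 (hw0 i)
        have h3 := mul_le_mul_of_nonneg_right (hw i j (Finset.mem_filter.1 hj).2)
          (norm_nonneg (x s j - y s j))
        have h4 := mul_le_mul_of_nonneg_left (hFi j) hE
        linarith [hFi i]
      · rw [nsmul_eq_mul, hK, mul_assoc]
        exact mul_le_mul_of_nonneg_right (hcard R) (by positivity)
    · refine (mul_le_mul_of_nonneg_left (norm_sum_le _ _) (hw0 i)).trans ?_
      rw [Finset.mul_sum]
      refine (Finset.sum_le_card_nsmul _ _ (2 * W) fun j hj => ?_).trans ?_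
      · rw [Finset.mem_filter, Finset.mem_sdiff] at hj
        have h1 := norm_commutator_le (hx1 s i) (hx1 s j)
        have h2 := hclose i j hj.1.1 hj.1.2 hj.2
        nlinarith [hw0 i, norm_nonneg (x s i * x s j - x s j * x s i)]
      · rw [nsmul_eq_mul]
        nlinarith [hcard (S \ R)]
  have hgr := norm_le_gronwallBound_of_norm_deriv_right_le (f := F) (f' := F') (δ := 0) (K := K)
    (ε := 2 * c * W) (a := 0) (b := t)
    (fun s _ => (hFF' s).continuousAt.continuousWithinAt)
    (fun s _ => (hFF' s).hasDerivWithinAt)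
    (by
      have : F 0 = 0 := by ext i; simp [hF, hx, hy, heis_zero_time]
      simp [this])
    (fun s _ => hbound s) t ⟨ht, le_rfl⟩
  have hi : w i * ‖x t i - y t i‖ ≤ ‖F t‖ := by
    have := norm_le_pi_norm (F t) i
    rwa [hF, norm_smul, Real.norm_of_nonneg (hw0 i)] at this
  refine hi.trans (hgr.trans ?_)
  simp only [gronwallBound_of_K_ne_0 hK0.ne', sub_zero, zero_mul, zero_add]
  -- The choice of `K` makes the left side equal to `W / (1 + E)`.
  have h1 : 2 * c * W / K ≤ W := by
    rw [div_le_iff₀ hK0, hK]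
    nlinarith [mul_nonneg (mul_nonneg hW hcR.le) hE]
  have h2 : 0 ≤ Real.exp (K * t) - 1 := by
    have := Real.one_le_exp (x := K * t) (by positivity)
    linarith
  calc _ ≤ W * (Real.exp (K * t) - 1) := mul_le_mul_of_nonneg_right h1 h2
    _ ≤ _ := by linarith

end LiebRobinson

end LocalComposite

namespace LocalComposite

/-! ### The trace norm and its duality with the operator norm. -/

section TraceNorm

open scoped Matrix.Norms.L2Operator Kronecker ComplexOrder

variable {n : Type*} [Fintype n] [DecidableEq n]

theorem traceNorm_nonneg (ρ : Matrix n n ℂ) : 0 ≤ traceNorm ρ :=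
  Finset.sum_nonneg fun _ _ => Real.sqrt_nonneg _

/-- In an orthonormal eigenbasis $v_i$ of $\rho^\dagger\rho$ the vectors $\rho v_i$ have the
singular values as norms, so Cauchy-Schwarz bounds each diagonal entry of $W\rho$ by $\|W\|$ times a
singular value. -/
theorem norm_trace_mul_le (W ρ : Matrix n n ℂ) : ‖(W * ρ).trace‖ ≤ ‖W‖ * traceNorm ρ := by
  set hM := Matrix.isHermitian_conjTranspose_mul_self ρ
  have h1 : (W * ρ).trace = ∑ i, inner ℂ (hM.eigenvectorBasis i)
      (Matrix.toEuclideanLin (W * ρ) (hM.eigenvectorBasis i)) := by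
    rw [← LinearMap.trace_eq_sum_inner, Matrix.toEuclideanLin, Matrix.toLpLin_eq_toLin,
      Matrix.trace_toLin_eq]
  rw [h1, traceNorm, Finset.mul_sum]
  refine norm_sum_le_of_le _ fun i _ => (norm_inner_le_norm _ _).trans ?_
  rw [hM.eigenvectorBasis.norm_eq_one, one_mul]
  set v := hM.eigenvectorBasis i
  have h2 : Matrix.toEuclideanLin (W * ρ) v
      = Matrix.toEuclideanCLM (n := n) (𝕜 := ℂ) W
        (Matrix.toEuclideanCLM (n := n) (𝕜 := ℂ) ρ v) := by
    rw [← Matrix.coe_toEuclideanCLM_eq_toEuclideanLin, map_mul]; rfl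
  have h3 : ‖Matrix.toEuclideanCLM (n := n) (𝕜 := ℂ) ρ v‖ = Real.sqrt (hM.eigenvalues i) := by
    have h4 : Matrix.toEuclideanCLM (n := n) (𝕜 := ℂ) (ρᴴ * ρ) v = (hM.eigenvalues i : ℂ) • v := by
      have := hM.mulVec_eigenvectorBasis i
      ext j
      have := congrFun this j
      simpa using this
    have h5 : ‖Matrix.toEuclideanCLM (n := n) (𝕜 := ℂ) ρ v‖ ^ 2 = hM.eigenvalues i := by
      have h6 : inner ℂ v (Matrix.toEuclideanCLM (n := n) (𝕜 := ℂ) (ρᴴ * ρ) v)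
          = inner ℂ (Matrix.toEuclideanCLM (n := n) (𝕜 := ℂ) ρ v)
            (Matrix.toEuclideanCLM (n := n) (𝕜 := ℂ) ρ v) := by
        rw [map_mul, ← Matrix.star_eq_conjTranspose, map_star, mul_apply_eq_comp,
          ContinuousLinearMap.star_eq_adjoint, ContinuousLinearMap.adjoint_inner_right]
      rw [h4, inner_smul_right, inner_self_eq_norm_sq_to_K, inner_self_eq_norm_sq_to_K,
        hM.eigenvectorBasis.norm_eq_one] at h6
      have h7 : ((hM.eigenvalues i : ℝ) : ℂ)
          = ((‖Matrix.toEuclideanCLM (n := n) (𝕜 := ℂ) ρ v‖ ^ 2 : ℝ) : ℂ) := by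
        simpa using h6
      exact_mod_cast h7.symm
    rw [← h5, Real.sqrt_sq (norm_nonneg _)]
  rw [h2, ← h3]
  exact ContinuousLinearMap.le_opNorm _ _

/-- The polar decomposition supplies $W=|\rho|^{-1}\rho^\dagger$, for which $W\rho=|\rho|$. The
inverse is taken on the range of $|\rho|$ only: since `0⁻¹ = 0`, the diagonal form of $WW^\dagger$
has entries 0 and 1, also when $\rho$ is singular. -/
theorem exists_trace_mul_eq (ρ : Matrix n n ℂ) :
    ∃ W : Matrix n n ℂ, ‖W‖ ≤ 1 ∧ (W * ρ).trace = traceNorm ρ := by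
  set hM := Matrix.isHermitian_conjTranspose_mul_self ρ
  set U : Matrix n n ℂ := hM.eigenvectorUnitary.1
  have hU : Uᴴ * U = 1 := (Matrix.mem_unitaryGroup_iff' (A := U)).1 hM.eigenvectorUnitary.2
  have hU' : U ∈ unitary (Matrix n n ℂ) := hM.eigenvectorUnitary.2
  have hlam : ∀ i, 0 ≤ hM.eigenvalues i :=
    (Matrix.posSemidef_conjTranspose_mul_self ρ).eigenvalues_nonneg
  set lam : n → ℂ := fun i => (hM.eigenvalues i : ℂ)
  set d : n → ℂ := fun i => ((Real.sqrt (hM.eigenvalues i))⁻¹ : ℝ)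
  have hspec : ρᴴ * ρ = U * Matrix.diagonal lam * Uᴴ := by
    conv_lhs => rw [hM.spectral_theorem]
    rw [Unitary.conjStarAlgAut_apply]
    rfl
  have hd : (Matrix.diagonal d)ᴴ = Matrix.diagonal d := by
    rw [Matrix.diagonal_conjTranspose]
    congr 1
    ext i
    simp [d]
  have hmul : ∀ X Y : Matrix n n ℂ, U * X * Uᴴ * (U * Y * Uᴴ) = U * (X * Y) * Uᴴ := by
    intro X Y
    calc _ = U * X * (Uᴴ * U) * Y * Uᴴ := by simp only [mul_assoc]
      _ = _ := by rw [hU]; simp only [mul_assoc, mul_one]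
  refine ⟨U * Matrix.diagonal d * Uᴴ * ρᴴ, ?_, ?_⟩
  · have h1 : (U * Matrix.diagonal d * Uᴴ * ρᴴ) * star (U * Matrix.diagonal d * Uᴴ * ρᴴ)
        = U * Matrix.diagonal (fun i => d i * (lam i * d i)) * star U := by
      rw [Matrix.star_eq_conjTranspose, Matrix.conjTranspose_mul, Matrix.conjTranspose_mul,
        Matrix.conjTranspose_mul, hd, Matrix.conjTranspose_conjTranspose,
        Matrix.conjTranspose_conjTranspose]
      calc _ = U * Matrix.diagonal d * Uᴴ * ((ρᴴ * ρ) * (U * Matrix.diagonal d * Uᴴ)) := by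
            simp only [mul_assoc]
        _ = _ := by
            rw [hspec, hmul, hmul, Matrix.diagonal_mul_diagonal, Matrix.diagonal_mul_diagonal]
            rfl
    have h2 : ‖U * Matrix.diagonal (fun i => d i * (lam i * d i)) * star U‖ ≤ 1 := by
      rw [CStarRing.norm_mul_mem_unitary _ (Unitary.star_mem hU'),
        CStarRing.norm_mem_unitary_mul _ hU', Matrix.l2_opNorm_diagonal]
      refine (pi_norm_le_iff_of_nonneg zero_le_one).2 fun i => ?_
      have : d i * (lam i * d i) = (((Real.sqrt (hM.eigenvalues i))⁻¹ *
          (hM.eigenvalues i * (Real.sqrt (hM.eigenvalues i))⁻¹) : ℝ) : ℂ) := by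
        simp [d, lam]
      rw [this, Complex.norm_real]
      rcases (hlam i).eq_or_lt with h | h
      · simp [← h]
      · have hs := Real.sq_sqrt h.le
        have hs0 := (Real.sqrt_pos.2 h).ne'
        have : (Real.sqrt (hM.eigenvalues i))⁻¹ *
            (hM.eigenvalues i * (Real.sqrt (hM.eigenvalues i))⁻¹) = 1 := by
          field_simp
          exact hs.symm
        rw [this]; simp
    rw [← h1, CStarRing.norm_self_mul_star] at h2
    nlinarith [norm_nonneg (U * Matrix.diagonal d * Uᴴ * ρᴴ)]
  · rw [mul_assoc, hspec, hmul, Matrix.diagonal_mul_diagonal, Matrix.trace_mul_comm, ← mul_assoc,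
      hU, one_mul, Matrix.trace_diagonal, traceNorm, Complex.ofReal_sum]
    refine Finset.sum_congr rfl fun i _ => ?_
    simp only [d, lam]
    rw [← Complex.ofReal_mul]
    congr 1
    rcases (hlam i).eq_or_lt with h | h
    · simp [← h]
    · have hs := Real.sq_sqrt h.le
      have hs0 := (Real.sqrt_pos.2 h).ne'
      field_simp
      exact hs.symm

/-- The dual description of the trace norm; the triangle inequality and the bound for $A\rho B$
follow from it without any work on singular values. -/
theorem traceNorm_le_of_forall {ρ : Matrix n n ℂ} {c : ℝ}
    (h : ∀ W : Matrix n n ℂ, ‖W‖ ≤ 1 → ‖(W * ρ).trace‖ ≤ c) : traceNorm ρ ≤ c := by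
  obtain ⟨W, hW, hρ⟩ := exists_trace_mul_eq ρ
  have := h W hW
  rwa [hρ, Complex.norm_real, Real.norm_of_nonneg (traceNorm_nonneg ρ)] at this

theorem norm_trace_mul_le' {W : Matrix n n ℂ} (hW : ‖W‖ ≤ 1) (ρ : Matrix n n ℂ) :
    ‖(W * ρ).trace‖ ≤ traceNorm ρ :=
  (norm_trace_mul_le W ρ).trans (mul_le_of_le_one_left (traceNorm_nonneg ρ) hW)

theorem traceNorm_add_le (ρ σ : Matrix n n ℂ) :
    traceNorm (ρ + σ) ≤ traceNorm ρ + traceNorm σ :=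
  traceNorm_le_of_forall fun W hW => by
    rw [mul_add, Matrix.trace_add]
    exact norm_add_le_of_le (norm_trace_mul_le' hW ρ) (norm_trace_mul_le' hW σ)

theorem traceNorm_smul_le (c : ℂ) (ρ : Matrix n n ℂ) :
    traceNorm (c • ρ) ≤ ‖c‖ * traceNorm ρ :=
  traceNorm_le_of_forall fun W hW => by
    rw [mul_smul_comm, Matrix.trace_smul, norm_smul]
    exact mul_le_mul_of_nonneg_left (norm_trace_mul_le' hW ρ) (norm_nonneg c)

theorem traceNorm_zero : traceNorm (0 : Matrix n n ℂ) = 0 :=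
  le_antisymm (traceNorm_le_of_forall fun W _ => by simp) (traceNorm_nonneg _)

theorem traceNorm_mul_mul_le (A ρ B : Matrix n n ℂ) :
    traceNorm (A * ρ * B) ≤ ‖A‖ * ‖B‖ * traceNorm ρ :=
  traceNorm_le_of_forall fun W hW => by
    have h1 : (W * (A * ρ * B)).trace = ((B * W * A) * ρ).trace := by
      rw [← mul_assoc, Matrix.trace_mul_comm]
      simp only [mul_assoc]
    rw [h1]
    refine (norm_trace_mul_le _ _).trans (mul_le_mul_of_nonneg_right ?_ (traceNorm_nonneg ρ))
    have h2 : ‖B * W‖ ≤ ‖B‖ * 1 := norm_mul_le_of_le le_rfl hW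
    calc ‖B * W * A‖ ≤ ‖B‖ * 1 * ‖A‖ := norm_mul_le_of_le h2 le_rfl
      _ = _ := by ring

end TraceNorm

/-! ### Diamond-norm bounds and their calculus. -/

section Diamond

open scoped Matrix.Norms.L2Operator Kronecker ComplexOrder

variable {n : Type*} [Fintype n] [DecidableEq n]

/-- The ampliation `A ↦ A ⊗ 1`. -/
noncomputable def kroneckerOne : Matrix n n ℂ →⋆ₐ[ℂ] Matrix (n × n) (n × n) ℂ where
  toFun A := A ⊗ₖ 1
  map_one' := Matrix.one_kronecker_one
  map_mul' A B := by rw [← Matrix.mul_kronecker_mul, one_mul]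
  map_zero' := Matrix.zero_kronecker _
  map_add' A B := Matrix.add_kronecker _ _ _
  commutes' c := by
    rw [Algebra.algebraMap_eq_smul_one, Algebra.algebraMap_eq_smul_one, Matrix.smul_kronecker,
      Matrix.one_kronecker_one]
  map_star' A := by
    simp [Matrix.star_eq_conjTranspose, Matrix.conjTranspose_kronecker]

/-- Star homomorphisms between C⋆-algebras are contractive. -/
theorem norm_kroneckerOne_le (A : Matrix n n ℂ) : ‖kroneckerOne A‖ ≤ ‖A‖ :=
  NonUnitalStarAlgHom.norm_apply_le kroneckerOne A

/-- The map `ρ ↦ A ρ B`. -/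
noncomputable def mulBoth (A B : Matrix n n ℂ) : Module.End ℂ (Matrix n n ℂ) :=
  LinearMap.mulLeft ℂ A * LinearMap.mulRight ℂ B

theorem mulBoth_apply (A B ρ : Matrix n n ℂ) : mulBoth A B ρ = A * ρ * B := by
  simp [mulBoth, mul_assoc]

theorem ampliate_mulBoth (A B : Matrix n n ℂ) (ρ : Matrix (n × n) (n × n) ℂ) :
    ampliate (mulBoth A B) ρ = kroneckerOne A * ρ * kroneckerOne B := by
  ext x y
  simp only [ampliate, mulBoth_apply, Matrix.of_apply, Matrix.mul_apply, kroneckerOne,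
    StarAlgHom.coe_mk, Matrix.kroneckerMap_apply, Fintype.sum_prod_type, Matrix.one_apply,
    mul_ite, mul_one, mul_zero, ite_mul, zero_mul, Finset.sum_ite_eq, Finset.sum_ite_eq',
    Finset.mem_univ, if_true]

/-- The bound `‖(Φ ⊗ id) ρ‖₁ ≤ c ‖ρ‖₁` for all `ρ`. -/
def DiamondLE (Φ : Module.End ℂ (Matrix n n ℂ)) (c : ℝ) : Prop :=
  ∀ ρ : Matrix (n × n) (n × n) ℂ, traceNorm (ampliate Φ ρ) ≤ c * traceNorm ρ

namespace DiamondLE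

variable {Φ Ψ Θ : Module.End ℂ (Matrix n n ℂ)} {a b c : ℝ}

theorem mono (h : DiamondLE Φ a) (hab : a ≤ b) : DiamondLE Φ b := fun ρ =>
  (h ρ).trans (mul_le_mul_of_nonneg_right hab (traceNorm_nonneg ρ))

theorem mulBoth (A B : Matrix n n ℂ) : DiamondLE (mulBoth A B) (‖A‖ * ‖B‖) := fun ρ => by
  rw [ampliate_mulBoth]
  refine (traceNorm_mul_mul_le _ _ _).trans (mul_le_mul_of_nonneg_right ?_ (traceNorm_nonneg ρ))
  gcongr <;> exact norm_kroneckerOne_le _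

theorem zero : DiamondLE (0 : Module.End ℂ (Matrix n n ℂ)) 0 := fun ρ => by
  have : ampliate 0 ρ = 0 := by ext; simp [ampliate]
  simp [this, traceNorm_zero]

theorem add (h : DiamondLE Φ a) (h' : DiamondLE Ψ b) : DiamondLE (Φ + Ψ) (a + b) := fun ρ => by
  have : ampliate (Φ + Ψ) ρ = ampliate Φ ρ + ampliate Ψ ρ := by ext; simp [ampliate]
  rw [this, add_mul]
  exact (traceNorm_add_le _ _).trans (add_le_add (h ρ) (h' ρ))

theorem smul (h : DiamondLE Φ a) (z : ℂ) : DiamondLE (z • Φ) (‖z‖ * a) := fun ρ => by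
  have : ampliate (z • Φ) ρ = z • ampliate Φ ρ := by ext; simp [ampliate]
  rw [this, mul_assoc]
  exact (traceNorm_smul_le _ _).trans (mul_le_mul_of_nonneg_left (h ρ) (norm_nonneg z))

theorem neg (h : DiamondLE Φ a) : DiamondLE (-Φ) a := by
  have e : -Φ = (-1 : ℂ) • Φ := by ext; simp
  rw [e]
  simpa only [norm_neg, norm_one, one_mul] using h.smul (-1)

theorem sub (h : DiamondLE Φ a) (h' : DiamondLE Ψ b) : DiamondLE (Φ - Ψ) (a + b) := by
  rw [sub_eq_add_neg]
  exact h.add h'.neg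

theorem sum {ι : Type*} {s : Finset ι} {Φ : ι → Module.End ℂ (Matrix n n ℂ)} {a : ι → ℝ}
    (h : ∀ i ∈ s, DiamondLE (Φ i) (a i)) : DiamondLE (∑ i ∈ s, Φ i) (∑ i ∈ s, a i) := by
  classical
  induction s using Finset.induction_on with
  | empty => simpa using zero
  | insert i s hi ih =>
    rw [Finset.sum_insert hi, Finset.sum_insert hi]
    exact (h i (Finset.mem_insert_self i s)).add
      (ih fun j hj => h j (Finset.mem_insert_of_mem hj))

theorem mul (h : DiamondLE Φ a) (h' : DiamondLE Ψ b) (ha : 0 ≤ a) :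
    DiamondLE (Φ * Ψ) (a * b) := fun ρ => by
  have : ampliate (Φ * Ψ) ρ = ampliate Φ (ampliate Ψ ρ) := rfl
  rw [this, mul_assoc]
  exact (h _).trans (mul_le_mul_of_nonneg_left (h' ρ) ha)

theorem one : DiamondLE (1 : Module.End ℂ (Matrix n n ℂ)) 1 := fun ρ => by
  have : ampliate 1 ρ = ρ := rfl
  simp [this]

theorem mul_one (h : DiamondLE Φ 1) (h' : DiamondLE Ψ 1) : DiamondLE (Φ * Ψ) 1 := by
  simpa using h.mul h' zero_le_one

theorem pow (h : DiamondLE Φ 1) (k : ℕ) : DiamondLE (Φ ^ k) 1 := by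
  induction k with
  | zero => simpa using one
  | succ k ih => rw [pow_succ]; exact ih.mul_one h

/-- Telescoping through $\Phi\Psi'$: contractivity of $\Phi$ and $\Psi'$ suffices for the two errors
to add. The bounds for powers and for lists of channels iterate this. -/
theorem mul_sub_mul {Φ' Ψ' : Module.End ℂ (Matrix n n ℂ)} (hΦ : DiamondLE Φ 1)
    (hΨ' : DiamondLE Ψ' 1) (h : DiamondLE (Φ - Φ') a) (h' : DiamondLE (Ψ - Ψ') b) (ha : 0 ≤ a) :
    DiamondLE (Φ * Ψ - Φ' * Ψ') (a + b) := by
  have e : Φ * Ψ - Φ' * Ψ' = (Φ - Φ') * Ψ' + Φ * (Ψ - Ψ') := by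
    rw [sub_mul, mul_sub]; abel
  rw [e]
  have h1 := h.mul hΨ' ha
  have h2 := hΦ.mul h' zero_le_one
  rw [_root_.mul_one] at h1
  rw [one_mul] at h2
  exact h1.add h2

theorem pow_sub_pow (hΦ : DiamondLE Φ 1) (hΨ : DiamondLE Ψ 1) (h : DiamondLE (Φ - Ψ) a)
    (ha : 0 ≤ a) (k : ℕ) : DiamondLE (Φ ^ k - Ψ ^ k) (k * a) := by
  induction k with
  | zero => simpa using zero
  | succ k ih =>
    rw [pow_succ, pow_succ, Nat.cast_succ, add_mul, one_mul]
    exact mul_sub_mul (hΦ.pow k) hΨ ih h (by positivity)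

theorem prod_ofFn {m : ℕ} {Φ : Fin m → Module.End ℂ (Matrix n n ℂ)}
    (hΦ : ∀ i, DiamondLE (Φ i) 1) : DiamondLE (List.ofFn Φ).prod 1 := by
  induction m with
  | zero => simpa using one
  | succ m ih =>
    rw [List.ofFn_succ, List.prod_cons]
    exact (hΦ 0).mul_one (ih fun i => hΦ i.succ)

theorem prod_ofFn_sub {m : ℕ} {Φ Ψ : Fin m → Module.End ℂ (Matrix n n ℂ)}
    (hΦ : ∀ i, DiamondLE (Φ i) 1) (hΨ : ∀ i, DiamondLE (Ψ i) 1) (ha : 0 ≤ a)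
    (h : ∀ i, DiamondLE (Φ i - Ψ i) a) :
    DiamondLE ((List.ofFn Φ).prod - (List.ofFn Ψ).prod) (m * a) := by
  induction m with
  | zero => simpa using zero
  | succ m ih =>
    rw [List.ofFn_succ, List.ofFn_succ, List.prod_cons, List.prod_cons, Nat.cast_succ]
    refine (mul_sub_mul (hΦ 0) (prod_ofFn fun i => hΨ i.succ) (h 0)
      (ih (fun i => hΦ i.succ) (fun i => hΨ i.succ) fun i => h i.succ) ha).mono (le_of_eq ?_)
    ring

theorem diamondNorm_le (h : DiamondLE Φ a) (ha : 0 ≤ a) : diamondNorm Φ ≤ a := by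
  refine csSup_le ⟨_, 0, by simp [traceNorm_zero], rfl⟩ ?_
  rintro _ ⟨ρ, hρ, rfl⟩
  exact (h ρ).trans (mul_le_of_le_one_right ha hρ)

theorem diamondNorm_nonneg (Φ : Module.End ℂ (Matrix n n ℂ)) : 0 ≤ diamondNorm Φ :=
  Real.sSup_nonneg (by rintro _ ⟨ρ, _, rfl⟩; exact traceNorm_nonneg _)

/-- Any bound on $\Phi$ makes the supremum defining the diamond norm one over a bounded set, hence
not the default value of `sSup`; homogeneity then extends it from the unit ball to all operators. -/
theorem self (h : DiamondLE Φ a) : DiamondLE Φ (diamondNorm Φ) := fun ρ => by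
  have h' : DiamondLE Φ |a| := h.mono (le_abs_self a)
  rcases (traceNorm_nonneg ρ).eq_or_lt with h0 | h0
  · simpa [← h0] using h ρ
  have hle : traceNorm (((traceNorm ρ)⁻¹ : ℂ) • ρ) ≤ 1 := by
    refine (traceNorm_smul_le _ _).trans_eq ?_
    rw [norm_inv, Complex.norm_real, Real.norm_of_nonneg h0.le, inv_mul_cancel₀ h0.ne']
  have hsup : traceNorm (ampliate Φ (((traceNorm ρ)⁻¹ : ℂ) • ρ)) ≤ diamondNorm Φ := by
    refine le_csSup ⟨|a|, ?_⟩ ⟨_, hle, rfl⟩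
    rintro _ ⟨σ, hσ, rfl⟩
    exact (h' σ).trans (mul_le_of_le_one_right (abs_nonneg a) hσ)
  have hamp : ampliate Φ ρ
      = (traceNorm ρ : ℂ) • ampliate Φ (((traceNorm ρ)⁻¹ : ℂ) • ρ) := by
    have h1 : (traceNorm ρ : ℂ) ≠ 0 := by exact_mod_cast h0.ne'
    have h2 : ampliate Φ (((traceNorm ρ)⁻¹ : ℂ) • ρ)
        = ((traceNorm ρ)⁻¹ : ℂ) • ampliate Φ ρ := by
      ext x y
      have : (Matrix.of fun i j => (((traceNorm ρ)⁻¹ : ℂ) • ρ) (i, x.2) (j, y.2))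
          = ((traceNorm ρ)⁻¹ : ℂ) • Matrix.of fun i j => ρ (i, x.2) (j, y.2) := rfl
      change Φ (Matrix.of fun i j => (((traceNorm ρ)⁻¹ : ℂ) • ρ) (i, x.2) (j, y.2)) x.1 y.1 = _
      rw [this, map_smul]
      rfl
    rw [h2, smul_smul, mul_inv_cancel₀ h1, one_smul]
  rw [hamp, mul_comm (diamondNorm Φ)]
  refine (traceNorm_smul_le _ _).trans ?_
  rw [Complex.norm_real, Real.norm_of_nonneg h0.le]
  exact mul_le_mul_of_nonneg_left hsup h0.le

theorem conjChannel {V : Matrix n n ℂ} (hV : ‖V‖ ≤ 1) : DiamondLE (conjChannel V) 1 := by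
  refine (mulBoth V Vᴴ).mono ?_
  rw [Matrix.l2_opNorm_conjTranspose]
  exact mul_le_one₀ hV (norm_nonneg _) hV

/-- $V\rho V^\dagger-W\rho W^\dagger=(V-W)\rho V^\dagger+W\rho(V-W)^\dagger$, so passing from
unitaries to channels costs a factor 2. -/
theorem conjChannel_sub {V W : Matrix n n ℂ} (hV : ‖V‖ ≤ 1) (hW : ‖W‖ ≤ 1) :
    DiamondLE (LocalComposite.conjChannel V - LocalComposite.conjChannel W) (2 * ‖V - W‖) := by
  have e : LocalComposite.conjChannel V - LocalComposite.conjChannel W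
      = LocalComposite.mulBoth (V - W) Vᴴ + LocalComposite.mulBoth W (V - W)ᴴ := by
    refine LinearMap.ext fun ρ => ?_
    change LocalComposite.mulBoth V Vᴴ ρ - LocalComposite.mulBoth W Wᴴ ρ = _ + _
    simp only [mulBoth_apply, Matrix.conjTranspose_sub]
    noncomm_ring
  rw [e]
  refine ((mulBoth (V - W) Vᴴ).add (mulBoth W (V - W)ᴴ)).mono ?_
  rw [Matrix.l2_opNorm_conjTranspose, Matrix.l2_opNorm_conjTranspose]
  nlinarith [norm_nonneg (V - W)]

end DiamondLE

theorem conjChannel_mul (V W : Matrix n n ℂ) :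
    conjChannel (V * W) = conjChannel V * conjChannel W := by
  refine LinearMap.ext fun ρ => ?_
  simp [conjChannel, mul_assoc]

theorem conjChannel_one : conjChannel (1 : Matrix n n ℂ) = 1 := by
  refine LinearMap.ext fun ρ => ?_
  simp [conjChannel]

theorem conjChannel_pow (V : Matrix n n ℂ) (k : ℕ) : conjChannel (V ^ k) = conjChannel V ^ k := by
  induction k with
  | zero => simp [conjChannel_one]
  | succ k ih => rw [pow_succ, pow_succ, conjChannel_mul, ih]

theorem conjChannel_prod (c : List (Matrix n n ℂ)) :
    conjChannel c.prod = (c.map conjChannel).prod := by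
  induction c with
  | nil => simp [conjChannel_one]
  | cons V c ih => rw [List.prod_cons, conjChannel_mul, ih, List.map_cons, List.prod_cons]

end Diamond

end LocalComposite

namespace LocalComposite

/-! ### Evolutions $e^{-ixt}$ in a C⋆-algebra. -/

section Evol

open NormedSpace Complex

variable {A : Type*} [CStarAlgebra A]

/-- The element `e^{-ixt}` of a C⋆-algebra. -/
noncomputable def evol (x : A) (t : ℝ) : A := exp ((-(I * (t : ℂ))) • x)

theorem star_neg_I_mul_smul {x : A} (hx : star x = x) (t : ℝ) :
    star ((-(I * (t : ℂ))) • x) = -((-(I * (t : ℂ))) • x) := by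
  rw [star_smul, hx, ← neg_smul]
  congr 1
  simp

theorem norm_neg_I_mul_smul (x : A) (t : ℝ) : ‖(-(I * (t : ℂ))) • x‖ = |t| * ‖x‖ := by
  rw [norm_smul, norm_neg, norm_mul, norm_I, one_mul, Complex.norm_real, Real.norm_eq_abs]

theorem evol_eq_exp_smul (x : A) (t : ℝ) : evol x t = exp (t • ((-I) • x)) := by
  rw [evol, ← Complex.coe_smul, smul_smul]
  congr 2
  ring

theorem evol_mem_unitary {x : A} (hx : star x = x) (t : ℝ) : evol x t ∈ unitary A :=
  exp_mem_unitary_of_skew (star_neg_I_mul_smul hx t)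

theorem norm_evol_le {x : A} (hx : star x = x) (t : ℝ) : ‖evol x t‖ ≤ 1 :=
  norm_le_one_of_mem_unitary (evol_mem_unitary hx t)

theorem star_evol {x : A} (hx : star x = x) (t : ℝ) : star (evol x t) = evol x (-t) := by
  rw [evol, star_exp_of_skew (star_neg_I_mul_smul hx t), evol, ← neg_smul]
  congr 2
  push_cast
  ring

theorem evol_pow (x : A) (t : ℝ) (k : ℕ) : evol x t ^ k = evol x (k * t) := by
  let +nondep : NormedAlgebra ℚ A := .restrictScalars ℚ ℂ A
  rw [evol, evol, ← NormedSpace.exp_nsmul, ← Nat.cast_smul_eq_nsmul ℂ, smul_smul]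
  congr 2
  push_cast
  ring

theorem evol_zero_left (t : ℝ) : evol (0 : A) t = 1 := by simp [evol]

theorem norm_evol_sub_one_le {x : A} (hx : star x = x) (t : ℝ) :
    ‖evol x t - 1‖ ≤ |t| * ‖x‖ := by
  rw [← norm_neg_I_mul_smul]
  exact norm_exp_sub_one_le' (star_neg_I_mul_smul hx t)

theorem norm_evol_sub_one_add_le {x : A} (hx : star x = x) (t : ℝ) :
    ‖evol x t - 1 + (I * (t : ℂ)) • x‖ ≤ (|t| * ‖x‖) ^ 2 / 2 := by
  rw [← norm_neg_I_mul_smul]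
  simpa [evol, sub_neg_eq_add] using norm_exp_sub_one_sub_le (star_neg_I_mul_smul hx t)

theorem norm_commutator_smul (x y : A) (t : ℝ) :
    ‖((-(I * (t : ℂ))) • x) * ((-(I * (t : ℂ))) • y)
      - ((-(I * (t : ℂ))) • y) * ((-(I * (t : ℂ))) • x)‖ = t ^ 2 * ‖x * y - y * x‖ := by
  rw [smul_mul_smul_comm, smul_mul_smul_comm, ← smul_sub, norm_smul, norm_mul, norm_neg, norm_mul,
    norm_I, one_mul, Complex.norm_real, Real.norm_eq_abs, abs_mul_abs_self, sq]

theorem norm_evol_mul_evol_sub_le {x y : A} (hx : star x = x) (hy : star y = y) (t : ℝ) :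
    ‖evol x t * evol y t - evol (x + y) t‖ ≤ t ^ 2 / 2 * ‖x * y - y * x‖ := by
  have := norm_exp_mul_exp_sub_le (star_neg_I_mul_smul hx t) (star_neg_I_mul_smul hy t)
  rw [norm_commutator_smul, ← smul_add] at this
  refine this.trans_eq ?_
  ring

theorem norm_prod_evol_sub_le {ι : Type*} [DecidableEq ι] (h : ι → A) (hh : ∀ i, star (h i) = h i)
    (κ : ι → ι → ℝ) (hκ : ∀ i j, ‖h i * h j - h j * h i‖ = κ i j) (c : List ι) (hc : c.Nodup)
    (t : ℝ) :
    ‖(c.map fun i => evol (h i) t).prod - evol (∑ i ∈ c.toFinset, h i) t‖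
      ≤ t ^ 2 / 4 * ∑ i ∈ c.toFinset, ∑ j ∈ c.toFinset, κ i j := by
  have key := norm_prod_exp_sub_le (fun i => (-(I * (t : ℂ))) • h i)
    (fun i => star_neg_I_mul_smul (hh i) t) (fun i j => t ^ 2 * κ i j)
    (fun i j => by rw [← hκ, ← hκ, norm_sub_rev]) (fun i => by rw [← hκ]; positivity)
    (fun i j => by rw [norm_commutator_smul, hκ]) c hc
  simp only [← Finset.mul_sum, ← Finset.smul_sum] at key
  refine key.trans_eq ?_
  ring

end Evol

/-! ### Evolution channels to first order in time. -/

section Channels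

open scoped Matrix.Norms.L2Operator

variable {n : Type*} [Fintype n] [DecidableEq n]

theorem evolOp_eq_evol (H : Matrix n n ℂ) (t : ℝ) : evolOp H t = evol H t := rfl

theorem norm_evolOp_le {H : Matrix n n ℂ} (hH : H.IsHermitian) (t : ℝ) : ‖evolOp H t‖ ≤ 1 :=
  norm_evol_le hH t

theorem diamondLE_evolChannel {H : Matrix n n ℂ} (hH : H.IsHermitian) (t : ℝ) :
    DiamondLE (evolChannel H t) 1 :=
  DiamondLE.conjChannel (norm_evolOp_le hH t)

theorem evolChannel_pow (H : Matrix n n ℂ) (t : ℝ) (k : ℕ) :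
    evolChannel H t ^ k = evolChannel H (k * t) := by
  rw [evolChannel, ← conjChannel_pow]
  congr 1
  exact evol_pow H t k

theorem evolChannel_zero_left (t : ℝ) : evolChannel (0 : Matrix n n ℂ) t = 1 := by
  rw [evolChannel, evolOp_eq_evol, evol_zero_left, conjChannel_one]

/-- The commutator with `H` as a map on operators. -/
noncomputable def commMap (H : Matrix n n ℂ) : Module.End ℂ (Matrix n n ℂ) :=
  mulBoth H 1 - mulBoth 1 H

theorem commMap_apply (H ρ : Matrix n n ℂ) : commMap H ρ = H * ρ - ρ * H := by
  simp [commMap, mulBoth_apply]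

theorem commMap_sum_smul {ι : Type*} (s : Finset ι) (c : ι → ℂ) (H : ι → Matrix n n ℂ) :
    commMap (∑ j ∈ s, c j • H j) = ∑ j ∈ s, c j • commMap (H j) := by
  refine LinearMap.ext fun ρ => ?_
  simp only [commMap_apply, LinearMap.sum_apply, LinearMap.smul_apply, Finset.sum_mul,
    Finset.mul_sum, ← Finset.sum_sub_distrib, smul_sub, smul_mul_assoc, mul_smul_comm]

/-- The channel of `e^{-iHt}` up to first order in `t`. -/
theorem diamondLE_evolChannel_sub_one_add {H : Matrix n n ℂ} (hH : H.IsHermitian) (t : ℝ) :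
    DiamondLE (evolChannel H t - 1 + (Complex.I * (t : ℂ)) • commMap H) (2 * (t * ‖H‖) ^ 2) := by
  set V := evolOp H t
  set R := V - 1 + (Complex.I * (t : ℂ)) • H
  have hR : Rᴴ = Vᴴ - 1 - (Complex.I * (t : ℂ)) • H := by
    simp only [R, Matrix.conjTranspose_add, Matrix.conjTranspose_sub, Matrix.conjTranspose_one,
      Matrix.conjTranspose_smul, hH.eq]
    simp [sub_eq_add_neg]
  -- With $V=1-iHt+R$ the remainder is $R\rho+\rho R^\dagger+(V-1)\rho(V-1)^\dagger$. Its three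
  -- parts contribute 1/2, 1/2 and 1 times $(t\|H\|)^2$.
  have e : evolChannel H t - 1 + (Complex.I * (t : ℂ)) • commMap H
      = mulBoth R 1 + mulBoth 1 Rᴴ + mulBoth (V - 1) (V - 1)ᴴ := by
    refine LinearMap.ext fun ρ => ?_
    change mulBoth V Vᴴ ρ - ρ + (Complex.I * (t : ℂ)) • commMap H ρ = _ + _ + _
    simp only [mulBoth_apply, commMap_apply, hR, Matrix.conjTranspose_sub,
      Matrix.conjTranspose_one, R, add_mul, mul_sub, sub_mul, one_mul, mul_one, smul_sub,
      smul_mul_assoc, mul_smul_comm]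
    abel
  rw [e]
  have h1 : ‖R‖ ≤ (|t| * ‖H‖) ^ 2 / 2 := norm_evol_sub_one_add_le hH t
  have h2 : ‖V - 1‖ ≤ |t| * ‖H‖ := norm_evol_sub_one_le hH t
  have h3 : ‖(1 : Matrix n n ℂ)‖ ≤ 1 := norm_le_one_of_mem_unitary (one_mem _)
  refine (((DiamondLE.mulBoth R 1).add (DiamondLE.mulBoth 1 Rᴴ)).add
    (DiamondLE.mulBoth (V - 1) (V - 1)ᴴ)).mono ?_
  rw [Matrix.l2_opNorm_conjTranspose, Matrix.l2_opNorm_conjTranspose]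
  have h4 : (|t| * ‖H‖) ^ 2 = (t * ‖H‖) ^ 2 := by rw [mul_pow, sq_abs, mul_pow]
  rw [h4] at h1
  have h5 : ‖V - 1‖ * ‖V - 1‖ ≤ (t * ‖H‖) ^ 2 := by
    rw [← h4, sq]
    exact mul_le_mul h2 h2 (norm_nonneg _) (by positivity)
  nlinarith [norm_nonneg R]

end Channels

/-! ### The error of the composite channel on one block. -/

section Composite

open scoped Matrix.Norms.L2Operator

variable {D L q : ℕ} (H : LocalHamiltonian D L q)

namespace LocalHamiltonian

theorem weight_nonneg (j : Fin H.numTerms) : 0 ≤ H.weight j := norm_nonneg (H.term j)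

theorem weight_smul_unitTerm (j : Fin H.numTerms) :
    (H.weight j : ℂ) • H.unitTerm j = H.term j := by
  rw [unitTerm, smul_smul]
  by_cases h : H.weight j = 0
  · have h0 : H.term j = 0 := norm_eq_zero.1 h
    simp [h0]
  · rw [mul_inv_cancel₀ (by exact_mod_cast h), one_smul]

theorem norm_unitTerm_le (j : Fin H.numTerms) : ‖H.unitTerm j‖ ≤ 1 := by
  rw [unitTerm, norm_smul, norm_inv, Complex.norm_real, Real.norm_of_nonneg (H.weight_nonneg j)]
  exact inv_mul_le_one

theorem isHermitian_unitTerm (j : Fin H.numTerms) : (H.unitTerm j).IsHermitian := by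
  rw [Matrix.IsHermitian, unitTerm, Matrix.conjTranspose_smul, H.isHermitian j]
  simp

theorem isHermitian_sum (s : Finset (Fin H.numTerms)) : (∑ j ∈ s, H.term j).IsHermitian := by
  rw [Matrix.IsHermitian, Matrix.conjTranspose_sum]
  exact Finset.sum_congr rfl fun j _ => H.isHermitian j

theorem isHermitian_onRegion (Y : Finset (Site D L)) : (H.onRegion Y).IsHermitian :=
  H.isHermitian_sum _

theorem norm_commutator_term (i j : Fin H.numTerms) :
    ‖H.term i * H.term j - H.term j * H.term i‖
      = H.weight i * H.weight j * opNorm ⁅H.unitTerm i, H.unitTerm j⁆ := by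
  rw [← H.weight_smul_unitTerm i, ← H.weight_smul_unitTerm j, smul_mul_smul_comm,
    smul_mul_smul_comm, mul_comm (H.weight j : ℂ), ← smul_sub, norm_smul, norm_mul,
    Complex.norm_real, Complex.norm_real, Real.norm_of_nonneg (H.weight_nonneg i),
    Real.norm_of_nonneg (H.weight_nonneg j)]
  rfl

end LocalHamiltonian

namespace Partition

variable {H} {Y : Finset (Site D L)} (P : Partition H Y)

theorem onRegion_eq :
    H.onRegion Y = (∑ j ∈ P.qdrift, H.term j) + ∑ j ∈ P.trotter.toFinset, H.term j := by
  have hd : Disjoint P.qdrift P.trotter.toFinset := by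
    rw [Finset.disjoint_right]
    exact fun j hj => P.disjoint j (List.mem_toFinset.1 hj)
  rw [← Finset.sum_union hd]
  refine Finset.sum_congr (Finset.ext fun j => ?_) fun _ _ => rfl
  simp [← P.mem_iff j, or_comm]

theorem lambda_nonneg : 0 ≤ P.lambda := Finset.sum_nonneg fun j _ => H.weight_nonneg j

theorem diamondLE_trotterChannel (t : ℝ) : DiamondLE (P.trotterChannel t) 1 := by
  refine DiamondLE.conjChannel (norm_le_one_of_mem_unitary ?_)
  refine list_prod_mem fun u hu => ?_
  obtain ⟨j, _, rfl⟩ := List.mem_map.1 hu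
  exact evol_mem_unitary (H.isHermitian j) t

theorem diamondLE_qdriftChannel (t : ℝ) : DiamondLE (P.qdriftChannel t) 1 := by
  rw [qdriftChannel]
  split_ifs with h
  · exact DiamondLE.one
  · refine (DiamondLE.sum fun j _ => (diamondLE_evolChannel (H.isHermitian_unitTerm j)
      (P.lambda * t)).smul ((H.weight j / P.lambda : ℝ) : ℂ)).mono (le_of_eq ?_)
    simp_rw [mul_one, Complex.norm_real,
      fun j => Real.norm_of_nonneg (div_nonneg (H.weight_nonneg j) P.lambda_nonneg)]
    rw [← Finset.sum_div]
    exact div_self h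

theorem diamondLE_trotterChannel_sub (t : ℝ) :
    DiamondLE (P.trotterChannel t - evolChannel (∑ j ∈ P.trotter.toFinset, H.term j) t)
      (t ^ 2 / 2 * P.commAA) := by
  have h1 : ‖(P.trotter.map fun j => evolOp (H.term j) t).prod
      - evolOp (∑ j ∈ P.trotter.toFinset, H.term j) t‖ ≤ t ^ 2 / 4 * P.commAA :=
    norm_prod_evol_sub_le H.term H.isHermitian _ H.norm_commutator_term P.trotter P.nodup t
  have h2 : ‖(P.trotter.map fun j => evolOp (H.term j) t).prod‖ ≤ 1 := by
    refine norm_le_one_of_mem_unitary (list_prod_mem fun u hu => ?_)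
    obtain ⟨j, _, rfl⟩ := List.mem_map.1 hu
    exact evol_mem_unitary (H.isHermitian j) t
  refine (DiamondLE.conjChannel_sub h2 (norm_evolOp_le (H.isHermitian_sum _) t)).mono ?_
  linarith

theorem norm_sum_qdrift_le : ‖∑ j ∈ P.qdrift, H.term j‖ ≤ P.lambda :=
  norm_sum_le _ _

/-- The first-order terms cancel because $\sum_j (b_j/\lambda_B)\,\lambda_B B_j=\sum_j b_jB_j$. The
averaged channel and the exact one each leave a remainder of at most $2(\lambda_B t)^2$. If
$\lambda_B=0$, the sum of the QDrift terms vanishes and both channels are the identity. -/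
theorem diamondLE_qdriftChannel_sub (t : ℝ) :
    DiamondLE (P.qdriftChannel t - evolChannel (∑ j ∈ P.qdrift, H.term j) t)
      (4 * P.lambda ^ 2 * t ^ 2) := by
  have hB := P.norm_sum_qdrift_le
  by_cases h : P.lambda = 0
  · rw [h] at hB
    rw [norm_le_zero_iff.1 hB, evolChannel_zero_left, qdriftChannel, if_pos h, sub_self, h]
    simpa using DiamondLE.zero
  · have hl := P.lambda_nonneg.lt_of_ne' h
    set p : Fin H.numTerms → ℝ := fun j => H.weight j / P.lambda with hp
    have hp0 : ∀ j, 0 ≤ p j := fun j => div_nonneg (H.weight_nonneg j) P.lambda_nonneg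
    have hp1 : ∑ j ∈ P.qdrift, p j = 1 := by
      rw [← Finset.sum_div]
      exact div_self h
    have hp1' : ∑ j ∈ P.qdrift, (p j : ℂ) = 1 := by exact_mod_cast hp1
    have e : P.qdriftChannel t - evolChannel (∑ j ∈ P.qdrift, H.term j) t
        = (∑ j ∈ P.qdrift, (p j : ℂ) • (evolChannel (H.unitTerm j) (P.lambda * t) - 1
            + (Complex.I * ((P.lambda * t : ℝ) : ℂ)) • commMap (H.unitTerm j)))
          - (evolChannel (∑ j ∈ P.qdrift, H.term j) t - 1
            + (Complex.I * (t : ℂ)) • commMap (∑ j ∈ P.qdrift, H.term j)) := by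
      have h1 : (∑ j ∈ P.qdrift, H.term j)
          = ∑ j ∈ P.qdrift, (H.weight j : ℂ) • H.unitTerm j :=
        Finset.sum_congr rfl fun j _ => (H.weight_smul_unitTerm j).symm
      have h2 : (Complex.I * (t : ℂ)) • commMap (∑ j ∈ P.qdrift, H.term j)
          = ∑ j ∈ P.qdrift, (p j : ℂ) •
            (Complex.I * ((P.lambda * t : ℝ) : ℂ)) • commMap (H.unitTerm j) := by
        rw [h1, commMap_sum_smul, Finset.smul_sum]
        refine Finset.sum_congr rfl fun j _ => ?_
        rw [smul_smul, smul_smul]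
        congr 1
        have : (P.lambda : ℂ) ≠ 0 := by exact_mod_cast h
        simp only [hp]
        push_cast
        field_simp
      rw [h2, qdriftChannel, if_neg h]
      simp only [smul_add, smul_sub, Finset.sum_add_distrib, Finset.sum_sub_distrib]
      rw [← Finset.sum_smul, hp1', one_smul]
      abel
    rw [e]
    refine ((DiamondLE.sum fun j _ => (diamondLE_evolChannel_sub_one_add
      (H.isHermitian_unitTerm j) (P.lambda * t)).smul (p j : ℂ)).sub
      (diamondLE_evolChannel_sub_one_add (H.isHermitian_sum P.qdrift) t)).mono ?_
    have h3 : ∑ j ∈ P.qdrift, ‖(p j : ℂ)‖ * (2 * (P.lambda * t * ‖H.unitTerm j‖) ^ 2)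
        ≤ ∑ j ∈ P.qdrift, p j * (2 * (P.lambda * t) ^ 2) := by
      refine Finset.sum_le_sum fun j _ => ?_
      rw [Complex.norm_real, Real.norm_of_nonneg (hp0 j), mul_pow]
      have h4 : ‖H.unitTerm j‖ ^ 2 ≤ 1 := pow_le_one₀ (norm_nonneg _) (H.norm_unitTerm_le j)
      have h5 := hp0 j
      gcongr
      exact mul_le_of_le_one_right (sq_nonneg _) h4
    rw [← Finset.sum_mul, hp1, one_mul] at h3
    have h6 : (t * ‖∑ j ∈ P.qdrift, H.term j‖) ^ 2 ≤ (t * P.lambda) ^ 2 := by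
      rw [mul_pow, mul_pow]
      gcongr
    nlinarith

theorem commAA_nonneg : 0 ≤ P.commAA :=
  Finset.sum_nonneg fun i _ => Finset.sum_nonneg fun j _ =>
    mul_nonneg (mul_nonneg (H.weight_nonneg i) (H.weight_nonneg j)) (norm_nonneg _)

theorem commAB_nonneg : 0 ≤ P.commAB :=
  Finset.sum_nonneg fun i _ => Finset.sum_nonneg fun j _ =>
    mul_nonneg (mul_nonneg (H.weight_nonneg i) (H.weight_nonneg j)) (norm_nonneg _)

theorem errorBound_nonneg (t : ℝ) (r : ℕ) : 0 ≤ P.errorBound t r := by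
  have h1 := P.commAA_nonneg
  have h2 := P.commAB_nonneg
  unfold errorBound
  positivity

theorem diamondLE_compositeChannel (t : ℝ) : DiamondLE (P.compositeChannel t) 1 :=
  ((P.diamondLE_qdriftChannel _).pow _).mul_one (P.diamondLE_trotterChannel t)

theorem norm_commutator_sum_le :
    ‖(∑ j ∈ P.qdrift, H.term j) * (∑ i ∈ P.trotter.toFinset, H.term i)
      - (∑ i ∈ P.trotter.toFinset, H.term i) * ∑ j ∈ P.qdrift, H.term j‖ ≤ P.commAB := by
  rw [norm_sub_rev, Finset.sum_mul_sum, Finset.sum_mul_sum, Finset.sum_comm (s := P.qdrift),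
    ← Finset.sum_sub_distrib]
  refine norm_sum_le_of_le _ fun i _ => ?_
  rw [← Finset.sum_sub_distrib]
  exact norm_sum_le_of_le _ fun j _ => (H.norm_commutator_term i j).le

/-- Three errors add: the samples, $N_B\cdot 4\lambda_B^2(t/N_B)^2$; the Trotter product of the $A$
terms; and the splitting $e^{-iBt}e^{-iAt}\approx e^{-i(A+B)t}$, which produces the mixed
commutators. -/
theorem diamondLE_compositeChannel_sub (t : ℝ) :
    DiamondLE (P.compositeChannel t - evolChannel (H.onRegion Y) t)
      (t ^ 2 / 2 * (P.commAA + 2 * P.commAB) + 4 * P.lambda ^ 2 * t ^ 2 / P.samples) := by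
  have hN : (P.samples : ℝ) ≠ 0 := by exact_mod_cast (Nat.one_le_iff_ne_zero.1 P.samples_pos)
  set B := ∑ j ∈ P.qdrift, H.term j
  set A := ∑ j ∈ P.trotter.toFinset, H.term j
  have hB : B.IsHermitian := H.isHermitian_sum _
  have hA : A.IsHermitian := H.isHermitian_sum _
  have h1 : DiamondLE (P.qdriftChannel (t / P.samples) ^ P.samples - evolChannel B t)
      (P.samples * (4 * P.lambda ^ 2 * (t / P.samples) ^ 2)) := by
    have := DiamondLE.pow_sub_pow (P.diamondLE_qdriftChannel (t / P.samples))
      (diamondLE_evolChannel hB (t / P.samples)) (P.diamondLE_qdriftChannel_sub (t / P.samples))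
      (by positivity) P.samples
    rwa [evolChannel_pow, mul_div_cancel₀ _ hN] at this
  have h2 := DiamondLE.mul_sub_mul ((P.diamondLE_qdriftChannel (t / P.samples)).pow P.samples)
    (diamondLE_evolChannel hA t) h1 (P.diamondLE_trotterChannel_sub t) (by positivity)
  have h3 : DiamondLE (evolChannel B t * evolChannel A t - evolChannel (B + A) t)
      (2 * (t ^ 2 / 2 * P.commAB)) := by
    rw [evolChannel, evolChannel, ← conjChannel_mul]
    have hBA : ‖evolOp B t * evolOp A t‖ ≤ 1 := norm_le_one_of_mem_unitary
      (mul_mem (evol_mem_unitary hB t) (evol_mem_unitary hA t))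
    refine (DiamondLE.conjChannel_sub hBA (norm_evolOp_le (hB.add hA) t)).mono ?_
    have h4 : ‖evolOp B t * evolOp A t - evolOp (B + A) t‖ ≤ t ^ 2 / 2 * ‖B * A - A * B‖ :=
      norm_evol_mul_evol_sub_le hB hA t
    have h5 := P.norm_commutator_sum_le
    have h6 : t ^ 2 / 2 * ‖B * A - A * B‖ ≤ t ^ 2 / 2 * P.commAB :=
      mul_le_mul_of_nonneg_left h5 (by positivity)
    linarith
  have e : P.compositeChannel t - evolChannel (H.onRegion Y) t
      = (P.qdriftChannel (t / P.samples) ^ P.samples * P.trotterChannel t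
          - evolChannel B t * evolChannel A t)
        + (evolChannel B t * evolChannel A t - evolChannel (B + A) t) := by
    rw [compositeChannel, P.onRegion_eq]
    abel
  rw [e]
  refine (h2.add h3).mono (le_of_eq ?_)
  field_simp
  ring

/-- The one-step error is quadratic in time, so $r$ steps of length $t/r$ cost $1/r$ of the error of
a single step, and reversing time changes nothing. -/
theorem diamondLE_compositeChannel_pow_sub {s : ℝ} (hs : s ^ 2 = 1) (t : ℝ) {r : ℕ}
    (hr : 1 ≤ r) :
    DiamondLE (P.compositeChannel (s * (t / r)) ^ r - evolChannel (H.onRegion Y) (s * t))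
      (P.errorBound t r) := by
  have hN : (P.samples : ℝ) ≠ 0 := by exact_mod_cast (Nat.one_le_iff_ne_zero.1 P.samples_pos)
  have hr0 : (r : ℝ) ≠ 0 := by exact_mod_cast (Nat.one_le_iff_ne_zero.1 hr)
  have h1 := P.commAA_nonneg
  have h2 := P.commAB_nonneg
  have h := DiamondLE.pow_sub_pow (P.diamondLE_compositeChannel (s * (t / r)))
    (diamondLE_evolChannel (H.isHermitian_onRegion Y) (s * (t / r)))
    (P.diamondLE_compositeChannel_sub (s * (t / r))) (by positivity) r
  rw [evolChannel_pow, mul_left_comm, mul_div_cancel₀ _ hr0] at h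
  refine h.mono (le_of_eq ?_)
  rw [mul_pow, hs, errorBound]
  field_simp

end Partition

end Composite

end LocalComposite

namespace LocalComposite

/-! ### Operators with disjoint supports commute. -/

section Support

variable {D L q : ℕ}

theorem SupportedOn.mul_apply {M N : Op D L q} {X Y : Finset (Site D L)}
    {M' : Matrix (X → Fin q) (X → Fin q) ℂ}
    (hM : ∀ σ τ : Config D L q, M σ τ =
      if ∀ x, x ∉ X → σ x = τ x then M' (fun x => σ x) (fun x => τ x) else 0)
    {N' : Matrix (Y → Fin q) (Y → Fin q) ℂ}
    (hN : ∀ σ τ : Config D L q, N σ τ =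
      if ∀ x, x ∉ Y → σ x = τ x then N' (fun x => σ x) (fun x => τ x) else 0)
    (hXY : Disjoint X Y) (σ τ : Config D L q) :
    (M * N) σ τ = if ∀ x, x ∉ X → x ∉ Y → σ x = τ x
      then M' (fun x => σ x) (fun x => τ x) * N' (fun x => σ x) (fun x => τ x) else 0 := by
  classical
  -- The only intermediate configuration that can contribute: `M` changes only sites in `X`, and `N`
  -- changes none of them. The resulting formula is symmetric in the two operators, which gives
  -- commutation.
  set ρ : Config D L q := fun x => if x ∈ X then τ x else σ x
  have hX : (fun x : X => ρ x) = fun x : X => τ x := by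
    funext x; simp [ρ]
  have hY : (fun x : Y => ρ x) = fun x : Y => σ x := by
    funext x
    have : (x : Site D L) ∉ X := Finset.disjoint_right.1 hXY x.2
    simp [ρ, this]
  rw [Matrix.mul_apply, Finset.sum_eq_single ρ]
  · rw [hM, hN, hX, hY, if_pos (fun x hx => by simp [ρ, hx])]
    have : (∀ x, x ∉ Y → ρ x = τ x) ↔ ∀ x, x ∉ X → x ∉ Y → σ x = τ x := by
      refine forall_congr' fun x => ?_
      by_cases hx : x ∈ X <;> simp [ρ, hx]
    simp only [this, mul_ite, mul_zero]
  · intro κ _ hκ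
    rw [hM, hN]
    by_contra hne
    have h1 : ∀ x, x ∉ X → σ x = κ x := by
      by_contra h; exact hne (by rw [if_neg h, zero_mul])
    have h2 : ∀ x, x ∉ Y → κ x = τ x := by
      by_contra h; exact hne (by rw [if_neg h, mul_zero])
    refine hκ (funext fun x => ?_)
    by_cases hx : x ∈ X
    · simpa [ρ, hx] using h2 x (Finset.disjoint_left.1 hXY hx)
    · simpa [ρ, hx] using (h1 x hx).symm
  · exact fun h => absurd (Finset.mem_univ ρ) h

theorem SupportedOn.commute {M N : Op D L q} {X Y : Finset (Site D L)} (hM : SupportedOn M X)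
    (hN : SupportedOn N Y) (hXY : Disjoint X Y) : Commute M N := by
  obtain ⟨M', hM⟩ := hM
  obtain ⟨N', hN⟩ := hN
  refine Matrix.ext fun σ τ => ?_
  rw [SupportedOn.mul_apply hM hN hXY, SupportedOn.mul_apply hN hM hXY.symm]
  refine if_congr ⟨fun h x hx hy => h x hy hx, fun h x hx hy => h x hy hx⟩ (mul_comm _ _) rfl

end Support

/-! ### Sets of diameter at most one in the lattice. -/

section Geometry

variable {D L : ℕ}

/-- A set of sites with diameter at most one. -/
def Small (X : Finset (Site D L)) : Prop := ∀ x ∈ X, ∀ y ∈ X, latticeDist x y ≤ 1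

theorem abs_sub_le_latticeDist (x y : Site D L) (k : Fin D) :
    |((x k : ℕ) : ℤ) - ((y k : ℕ) : ℤ)| ≤ latticeDist x y :=
  Finset.single_le_sum (f := fun k => |((x k : ℕ) : ℤ) - ((y k : ℕ) : ℤ)|)
    (fun _ _ => abs_nonneg _) (Finset.mem_univ k)

theorem Small.coord_le {X : Finset (Site D L)} (hX : Small X) {x y : Site D L} (hx : x ∈ X)
    (hy : y ∈ X) (k : Fin D) : (x k : ℕ) ≤ (y k : ℕ) + 1 := by
  have := (abs_sub_le_latticeDist x y k).trans (hX x hx y hy)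
  rw [abs_le] at this
  omega

theorem small_singleton (x : Site D L) : Small {x} := by
  intro a ha b hb
  rw [Finset.mem_singleton] at ha hb
  subst ha hb
  simp [latticeDist]

/-- The sites whose coordinates differ by at most two from those of `x`. -/
def nearby (x : Site D L) : Finset (Site D L) :=
  Fintype.piFinset fun k => Finset.univ.filter fun i : Fin L =>
    (x k : ℕ) ≤ (i : ℕ) + 2 ∧ (i : ℕ) ≤ (x k : ℕ) + 2

theorem card_nearby_le (x : Site D L) : (nearby x).card ≤ 5 ^ D := by
  rw [nearby, Fintype.card_piFinset]
  refine (Finset.prod_le_pow_card _ _ 5 fun k _ => ?_).trans_eq (by simp)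
  have := Finset.card_le_card_of_injOn (t := Finset.Icc ((x k : ℕ) - 2) ((x k : ℕ) + 2))
    (s := Finset.univ.filter fun i : Fin L =>
      (x k : ℕ) ≤ (i : ℕ) + 2 ∧ (i : ℕ) ≤ (x k : ℕ) + 2) (fun i : Fin L => (i : ℕ))
    (fun i hi => by
      simp only [Finset.coe_filter, Finset.mem_univ, true_and, Set.mem_ofPred_eq] at hi
      simp only [Finset.coe_Icc, Set.mem_Icc]
      omega)
    (fun i _ j _ h => Fin.ext h)
  refine this.trans ?_
  rw [Nat.card_Icc]
  omega

variable (D L) in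
/-- The possible supports of the terms of a local Hamiltonian. -/
abbrev SmallSet : Type := {X : Finset (Site D L) // Small X}

noncomputable instance : Fintype (SmallSet D L) := Fintype.ofFinite _

theorem card_smallSet_le (x : Site D L) {s : Finset (SmallSet D L)}
    (hs : ∀ X ∈ s, X.1 ⊆ nearby x) : s.card ≤ 2 ^ 5 ^ D := by
  have := Finset.card_le_card_of_injOn (s := s) (t := (nearby x).powerset) Subtype.val
    (fun X hX => by simpa using hs X hX) (fun X _ Y _ h => Subtype.ext h)
  rw [Finset.card_powerset] at this
  exact this.trans (Nat.pow_le_pow_right two_pos (card_nearby_le x))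

open Classical in
-- Fix a site `x` of the given set. A site of an intersecting set differs from `x` by at most two in
-- each coordinate, so intersecting sets are subsets of a cube of at most $5^D$ sites. The bound
-- does not depend on `L`.
theorem card_intersecting_le (X : SmallSet D L) :
    (Finset.univ.filter fun Z : SmallSet D L => ¬Disjoint X.1 Z.1).card ≤ 2 ^ 5 ^ D := by
  rcases X.1.eq_empty_or_nonempty with h | ⟨x, hx⟩
  · simp [h]
  · refine card_smallSet_le x fun Z hZ z hz => ?_
    obtain ⟨y, hyX, hyZ⟩ := Finset.not_disjoint_iff.1 (Finset.mem_filter.1 hZ).2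
    rw [nearby, Fintype.mem_piFinset]
    intro k
    have h1 := X.2.coord_le hx hyX k
    have h2 := X.2.coord_le hyX hx k
    have h3 := Z.2.coord_le hz hyZ k
    have h4 := Z.2.coord_le hyZ hz k
    simp only [Finset.mem_filter, Finset.mem_univ, true_and]
    omega

open Classical in
theorem card_containing_le (x : Site D L) :
    (Finset.univ.filter fun Z : SmallSet D L => x ∈ Z.1).card ≤ 2 ^ 5 ^ D := by
  simpa using card_intersecting_le ⟨{x}, small_singleton x⟩

/-- The largest `k`-th coordinate in `X`. -/
def height (k : Fin D) (X : Finset (Site D L)) : ℕ := X.sup fun x => (x k : ℕ)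

theorem height_le_of_not_disjoint {X Z : SmallSet D L} (h : ¬Disjoint X.1 Z.1) (k : Fin D) :
    height k X.1 ≤ height k Z.1 + 1 := by
  obtain ⟨y, hyX, hyZ⟩ := Finset.not_disjoint_iff.1 h
  refine Finset.sup_le fun x hx => (X.2.coord_le hx hyX k).trans ?_
  exact Nat.succ_le_succ (Finset.le_sup (f := fun x : Site D L => (x k : ℕ)) hyZ)

/-- The part of `Q` with `k`-th coordinate in `[s, e)`. -/
def slab (Q : Finset (Site D L)) (k : Fin D) (s e : ℕ) : Finset (Site D L) :=
  Q.filter fun x => s ≤ (x k : ℕ) ∧ (x k : ℕ) < e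

theorem mem_slab {Q : Finset (Site D L)} {k : Fin D} {s e : ℕ} {x : Site D L} :
    x ∈ slab Q k s e ↔ x ∈ Q ∧ s ≤ (x k : ℕ) ∧ (x k : ℕ) < e := Finset.mem_filter

theorem slab_mono {Q : Finset (Site D L)} {k : Fin D} {s s' e e' : ℕ} (hs : s' ≤ s)
    (he : e ≤ e') : slab Q k s e ⊆ slab Q k s' e' := fun x hx => by
  rw [mem_slab] at hx ⊢
  exact ⟨hx.1, by omega, by omega⟩

open Classical in
/-- The small sets contained in `Y`. -/
noncomputable def inside (Y : Finset (Site D L)) : Finset (SmallSet D L) :=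
  Finset.univ.filter fun X => X.1 ⊆ Y

theorem mem_inside {Y : Finset (Site D L)} {X : SmallSet D L} : X ∈ inside Y ↔ X.1 ⊆ Y := by
  simp [inside]

end Geometry

/-! ### The Lieb-Robinson error of a single cut. -/

section Split

open Classical

variable {A : Type*} [CStarAlgebra A] {D L : ℕ}

/-- Skew-adjoint generators of norm at most one, attached to the small sets of sites, which commute
if their supports are disjoint. -/
structure IsLocalFamily (g : SmallSet D L → A) : Prop where
  skew : ∀ X, star (g X) = -g X
  norm_le : ∀ X, ‖g X‖ ≤ 1
  commute : ∀ X Z : SmallSet D L, Disjoint X.1 Z.1 → Commute (g X) (g Z)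

variable {g : SmallSet D L → A} {Q : Finset (Site D L)} {k : Fin D} {s p q e : ℕ}

/-- Inclusion-exclusion. As $p<q$, a site at or beyond $q$ and a site below $p$ are at least two
apart, so no small set has both: each one in $[s,e)$ lies in $[s,q)$ or in $[p,e)$. -/
theorem sum_inside_add (hsp : s ≤ p) (hpq : p < q) (hqe : q ≤ e) :
    (∑ X ∈ inside (slab Q k s e), g X) + ∑ X ∈ inside (slab Q k p q), g X
      = (∑ X ∈ inside (slab Q k s q), g X) + ∑ X ∈ inside (slab Q k p e), g X := by
  rw [← Finset.sum_union_inter (s₁ := inside (slab Q k s q))]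
  congr 1
  · refine Finset.sum_congr (Finset.ext fun X => ?_) fun _ _ => rfl
    rw [Finset.mem_union, mem_inside, mem_inside, mem_inside]
    refine ⟨fun h => ?_, fun h => ?_⟩
    · by_contra! hcon
      obtain ⟨x, hx, hx'⟩ := Finset.not_subset.1 hcon.1
      obtain ⟨y, hy, hy'⟩ := Finset.not_subset.1 hcon.2
      have h1 := mem_slab.1 (h hx)
      have h2 := mem_slab.1 (h hy)
      have h3 := X.2.coord_le hx hy k
      rw [mem_slab] at hx' hy'
      have h4 : ¬ (x k : ℕ) < q := fun h => hx' ⟨h1.1, h1.2.1, h⟩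
      have h5 : ¬ p ≤ (y k : ℕ) := fun h => hy' ⟨h2.1, h, h2.2.2⟩
      omega
    · rcases h with h | h
      · exact h.trans (slab_mono le_rfl hqe)
      · exact h.trans (slab_mono hsp le_rfl)
  · refine Finset.sum_congr (Finset.ext fun X => ?_) fun _ _ => rfl
    rw [Finset.mem_inter, mem_inside, mem_inside, mem_inside]
    refine ⟨fun h => ⟨h.trans (slab_mono hsp le_rfl), h.trans (slab_mono le_rfl hqe)⟩,
      fun h x hx => ?_⟩
    have h1 := mem_slab.1 (h.1 hx)
    have h2 := mem_slab.1 (h.2 hx)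
    exact mem_slab.2 ⟨h1.1, h2.2.1, h1.2.2⟩

/-- The number of neighbours of a small set is at most this constant. -/
def degBound (D : ℕ) : ℕ := 2 ^ 5 ^ D

/-- The exponential rate in the Lieb-Robinson bound. -/
noncomputable def lrRate (D : ℕ) : ℝ := degBound D * (2 + 2 * Real.exp 1)

theorem lrRate_nonneg (D : ℕ) : 0 ≤ lrRate D := by
  unfold lrRate; positivity

/-- The weight is $e^{\text{height}}$, which changes by a factor at most $e$ between intersecting
sets. The generators that distinguish the two regions reach below $p$, so sets meeting them have
height at most $p+1$, against at least $q$ for the observable. -/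
theorem IsLocalFamily.norm_heis_sub_le (hg : IsLocalFamily g) {X : SmallSet D L}
    (hX : q ≤ height k X.1) (hsp : s ≤ p) {t : ℝ} (ht : 0 ≤ t) :
    ‖heis (∑ X ∈ inside (slab Q k s q), g X) t (g X)
      - heis (∑ X ∈ inside (slab Q k p q), g X) t (g X)‖
      ≤ Real.exp (p + 1 - q) * Real.exp (lrRate D * t) := by
  have key := weight_mul_norm_heis_sub_le g hg.skew hg.norm_le
    (fun X Z : SmallSet D L => ¬Disjoint X.1 Z.1)
    (fun X Z h => hg.commute X Z (not_not.1 h)) (c := degBound D) Nat.one_le_two_pow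
    card_intersecting_le (S := inside (slab Q k s q)) (R := inside (slab Q k p q))
    (fun X hX => mem_inside.2 ((mem_inside.1 hX).trans (slab_mono hsp le_rfl)))
    (w := fun X => Real.exp (height k X.1)) (fun X => (Real.exp_pos _).le)
    (E := Real.exp 1) (W := Real.exp (p + 1)) (Real.exp_pos _).le (Real.exp_pos _).le
    (fun X Z h => by
      rw [← Real.exp_add, Real.exp_le_exp]
      have := height_le_of_not_disjoint h k
      have : (height k X.1 : ℝ) ≤ height k Z.1 + 1 := by exact_mod_cast this
      linarith)
    (fun X Z hZ hZ' h => by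
      rw [Real.exp_le_exp]
      rw [mem_inside] at hZ hZ'
      obtain ⟨z, hz, hz'⟩ := Finset.not_subset.1 hZ'
      obtain ⟨x, hxX, hxZ⟩ := Finset.not_disjoint_iff.1 h
      have h1 := mem_slab.1 (hZ hz)
      have h2 : ¬ p ≤ (z k : ℕ) := fun h => hz' (mem_slab.2 ⟨h1.1, h, h1.2.2⟩)
      have h3 := Z.2.coord_le hxZ hz k
      have h4 : height k X.1 ≤ p + 1 := Finset.sup_le fun y hy => by
        have := X.2.coord_le hy hxX k
        omega
      exact_mod_cast h4) ht X
  have h1 : Real.exp q * ‖heis (∑ X ∈ inside (slab Q k s q), g X) t (g X)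
      - heis (∑ X ∈ inside (slab Q k p q), g X) t (g X)‖
      ≤ Real.exp (p + 1) * Real.exp (lrRate D * t) := by
    refine le_trans (mul_le_mul_of_nonneg_right (Real.exp_le_exp.2 ?_) (norm_nonneg _)) key
    exact_mod_cast hX
  rw [Real.exp_sub, div_mul_eq_mul_div, le_div_iff₀ (Real.exp_pos _)]
  linarith

/-- Such a set has a site below $q$ and a site at or beyond $q$; diameter at most one forces the
former into the layer $q-1$. -/
theorem card_boundary_le {a : ℕ}
    (ha : ∀ i : ℕ, (Q.filter fun x => (x k : ℕ) = i).card ≤ a) :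
    (((inside (slab Q k p e)) \ inside (slab Q k p q)).filter
      fun X => ¬Disjoint X.1 (slab Q k s q)).card ≤ a * degBound D := by
  have hsub : (((inside (slab Q k p e)) \ inside (slab Q k p q)).filter
      fun X => ¬Disjoint X.1 (slab Q k s q)) ⊆
      (Q.filter fun x => (x k : ℕ) = q - 1).biUnion fun x =>
        Finset.univ.filter fun Z : SmallSet D L => x ∈ Z.1 := by
    intro X hX
    rw [Finset.mem_filter, Finset.mem_sdiff, mem_inside, mem_inside] at hX
    obtain ⟨⟨hX1, hX2⟩, hX3⟩ := hX
    obtain ⟨x, hx, hx'⟩ := Finset.not_subset.1 hX2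
    obtain ⟨y, hyX, hy⟩ := Finset.not_disjoint_iff.1 hX3
    have h1 := mem_slab.1 (hX1 hx)
    have h2 : ¬ (x k : ℕ) < q := fun h => hx' (mem_slab.2 ⟨h1.1, h1.2.1, h⟩)
    have h3 := X.2.coord_le hx hyX k
    have h4 := mem_slab.1 hy
    simp only [Finset.mem_biUnion, Finset.mem_filter, Finset.mem_univ, true_and]
    exact ⟨y, ⟨h4.1, by omega⟩, hyX⟩
  refine (Finset.card_le_card hsub).trans ((Finset.card_biUnion_le_card_mul _ _ (degBound D)
    fun x _ => card_containing_le x).trans ?_)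
  exact Nat.mul_le_mul_right _ (ha _)

/-- The evolution generated by the small sets contained in `Y`. -/
noncomputable def regionEvol (g : SmallSet D L → A) (Y : Finset (Site D L)) (t : ℝ) : A :=
  NormedSpace.exp (t • ∑ X ∈ inside Y, g X)

/-- The error of one cut of a slab. -/
theorem IsLocalFamily.norm_split_sub_le (hg : IsLocalFamily g) (hsp : s ≤ p) (hpq : p < q)
    (hqe : q ≤ e) {a : ℕ} (ha : ∀ i : ℕ, (Q.filter fun x => (x k : ℕ) = i).card ≤ a) {t : ℝ}
    (ht : 0 ≤ t) :
    ‖regionEvol g (slab Q k s q) t * (regionEvol g (slab Q k p q) (-t)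
      * regionEvol g (slab Q k p e) t) - regionEvol g (slab Q k s e) t‖
      ≤ a * degBound D * (Real.exp (p + 1 - q) * Real.exp (lrRate D * t)) * t := by
  simp only [regionEvol, neg_smul]
  refine norm_exp_split_sub_le (star_sum_of_skew hg.skew) (star_sum_of_skew hg.skew)
    (star_sum_of_skew hg.skew) (sum_inside_add hsp hpq hqe) ht fun u hu hut => ?_
  have hsub : inside (slab Q k p q) ⊆ inside (slab Q k p e) := fun X hX =>
    mem_inside.2 ((mem_inside.1 hX).trans (slab_mono le_rfl hqe))
  have hsdiff : (∑ X ∈ inside (slab Q k p e), g X) - ∑ X ∈ inside (slab Q k p q), g X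
      = ∑ X ∈ inside (slab Q k p e) \ inside (slab Q k p q), g X := by
    rw [sub_eq_iff_eq_add, Finset.sum_sdiff hsub]
  rw [hsdiff, heis_sum, heis_sum, ← Finset.sum_sub_distrib]
  -- Terms of $w-y$ disjoint from the slab $[s,q)$ commute with both generators and are not moved by
  -- either evolution. Only terms across the boundary at $q$ contribute.
  rw [← Finset.sum_filter_add_sum_filter_not _ (fun X => ¬Disjoint X.1 (slab Q k s q))]
  have hzero : ∑ X ∈ (inside (slab Q k p e) \ inside (slab Q k p q)).filter
      (fun X => ¬¬Disjoint X.1 (slab Q k s q)),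
      (heis (∑ X ∈ inside (slab Q k s q), g X) u (g X)
        - heis (∑ X ∈ inside (slab Q k p q), g X) u (g X)) = 0 := by
    refine Finset.sum_eq_zero fun X hX => ?_
    have hd := not_not.1 (Finset.mem_filter.1 hX).2
    rw [heis_of_commute, heis_of_commute, sub_self]
    · refine Commute.sum_right _ _ _ fun Z hZ => hg.commute X Z ?_
      exact Finset.disjoint_of_subset_right
        ((mem_inside.1 hZ).trans (slab_mono hsp le_rfl)) hd
    · exact Commute.sum_right _ _ _ fun Z hZ => hg.commute X Z
        (Finset.disjoint_of_subset_right (mem_inside.1 hZ) hd)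
  rw [hzero, add_zero]
  refine (norm_sum_le _ _).trans ((Finset.sum_le_card_nsmul _ _
    (Real.exp (p + 1 - q) * Real.exp (lrRate D * t)) fun X hX => ?_).trans ?_)
  · rw [Finset.mem_filter, Finset.mem_sdiff, mem_inside, mem_inside] at hX
    obtain ⟨x, hx, hx'⟩ := Finset.not_subset.1 hX.1.2
    have h1 := mem_slab.1 (hX.1.1 hx)
    have h2 : ¬ (x k : ℕ) < q := fun h => hx' (mem_slab.2 ⟨h1.1, h1.2.1, h⟩)
    have h3 : q ≤ height k X.1 :=
      (not_lt.1 h2).trans (Finset.le_sup (f := fun x : Site D L => (x k : ℕ)) hx)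
    refine (hg.norm_heis_sub_le h3 hsp hu).trans ?_
    have := lrRate_nonneg D
    gcongr
  · rw [nsmul_eq_mul]
    refine mul_le_mul_of_nonneg_right ?_ (by positivity)
    exact_mod_cast card_boundary_le ha

end Split

/-! ### The local Hamiltonian as a local family. -/

section Hamiltonian

open Classical

open scoped Matrix.Norms.L2Operator

variable {D L q : ℕ} (H : LocalHamiltonian D L q)

namespace LocalHamiltonian

/-- The support of a term. -/
def smallSupp (j : Fin H.numTerms) : SmallSet D L := ⟨H.supp j, H.diam_le j⟩

/-- The sum of the terms with support `X`. -/
noncomputable def onSupport (X : SmallSet D L) : Op D L q :=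
  ∑ j with H.supp j = X.1, H.term j

theorem onRegion_eq_sum_inside (Y : Finset (Site D L)) :
    H.onRegion Y = ∑ X ∈ inside Y, H.onSupport X := by
  rw [onRegion, ← Finset.sum_fiberwise_of_maps_to (s := Finset.univ.filter fun j => H.supp j ⊆ Y)
    (g := H.smallSupp) (t := inside Y)
    (fun j hj => mem_inside.2 (Finset.mem_filter.1 hj).2)]
  refine Finset.sum_congr rfl fun X hX => Finset.sum_congr (Finset.ext fun j => ?_) fun _ _ => rfl
  rw [mem_inside] at hX
  simp only [Finset.mem_filter, Finset.mem_univ, true_and, smallSupp, Subtype.ext_iff]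
  exact ⟨fun h => h.2, fun h => ⟨h ▸ hX, h⟩⟩

/-- Summands are grouped by support: the norm hypothesis bounds only the grouped sums, and the
neighbour count is then independent of how many summands share a support. -/
theorem isLocalFamily : IsLocalFamily fun X => (-Complex.I) • H.onSupport X where
  skew X := by
    have : (H.onSupport X)ᴴ = H.onSupport X := H.isHermitian_sum _
    rw [star_smul, Matrix.star_eq_conjTranspose, this, ← neg_smul]
    congr 1
    simp
  norm_le X := by
    rw [norm_smul, norm_neg, Complex.norm_I, one_mul]
    exact H.norm_le X.1
  commute X Z h := by
    refine Commute.smul_left (Commute.smul_right ?_ _) _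
    refine Commute.sum_left _ _ _ fun i hi => Commute.sum_right _ _ _ fun j hj => ?_
    refine (H.supported i).commute (H.supported j) ?_
    rw [(Finset.mem_filter.1 hi).2, (Finset.mem_filter.1 hj).2]
    exact h

theorem evolOp_onRegion (Y : Finset (Site D L)) (t : ℝ) :
    evolOp (H.onRegion Y) t
      = regionEvol (fun X => (-Complex.I) • H.onSupport X) Y t := by
  rw [regionEvol, ← Finset.smul_sum, ← H.onRegion_eq_sum_inside]
  exact evol_eq_exp_smul (H.onRegion Y) t

theorem norm_cut_sub_le {Q : Finset (Site D L)} {k : Fin D} {s p e f : ℕ} (hsp : s ≤ p)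
    (hpe : p < e) (hef : e ≤ f) {a : ℕ}
    (ha : ∀ i : ℕ, (Q.filter fun x => (x k : ℕ) = i).card ≤ a) {t : ℝ} (ht : 0 ≤ t) :
    ‖evolOp (H.onRegion (slab Q k s e)) t * (evolOp (H.onRegion (slab Q k p e)) (-t)
      * evolOp (H.onRegion (slab Q k p f)) t) - evolOp (H.onRegion (slab Q k s f)) t‖
      ≤ a * degBound D * (Real.exp (p + 1 - e) * Real.exp (lrRate D * t)) * t := by
  simp only [evolOp_onRegion]
  exact H.isLocalFamily.norm_split_sub_le hsp hpe hef ha ht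

end LocalHamiltonian

end Hamiltonian

end LocalComposite

namespace LocalComposite

/-! ### Counting the factors of a cut chain and their lengths. -/

section Chain

theorem OverlapsOK.le {L l : ℕ} : ∀ {s : ℕ} {c : List (ℕ × ℕ)}, OverlapsOK L l s c → s ≤ L
  | _, [], h => h
  | _, (p, q) :: c, h => by
    have := OverlapsOK.le h.2.2
    have h1 := h.1
    have h2 := h.2.1
    omega

theorem OverlapsOK.mul_length_le {L l : ℕ} :
    ∀ {s : ℕ} {c : List (ℕ × ℕ)}, OverlapsOK L l s c → l * c.length + s ≤ L
  | s, [], h => by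
    have : s ≤ L := h
    simpa using this
  | _, (p, q) :: c, h => by
    have := OverlapsOK.mul_length_le h.2.2
    have h1 := h.1
    have h2 := h.2.1
    rw [List.length_cons, Nat.mul_succ]
    omega

theorem length_chainFactors (L : ℕ) : ∀ (s : ℕ) (c : List (ℕ × ℕ)),
    (chainFactors L s c).length = 2 * c.length + 1
  | _, [] => rfl
  | _, (p, q) :: c => by
    rw [chainFactors, List.length_cons, List.length_cons, length_chainFactors L p c,
      List.length_cons]
    ring

/-- The chain starts at `s`, inside the previous overlap, which ends at `s₀`. Sites before `s₀` are
covered once; later ones at most three times, since overlaps are disjoint and each is covered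
forwards, backwards and forwards again. -/
theorem sum_length_chainFactors_le {L l : ℕ} : ∀ {s s₀ : ℕ} {c : List (ℕ × ℕ)}, s ≤ s₀ →
    OverlapsOK L l s₀ c →
    ((chainFactors L s c).map fun f => f.1.2 - f.1.1).sum ≤ (s₀ - s) + 3 * (L - s₀)
  | s, s₀, [], hs, h => by
    have : s₀ ≤ L := h
    simp only [chainFactors, List.map_cons, List.map_nil, List.sum_cons, List.sum_nil]
    omega
  | s, s₀, (p, q) :: c, hs, h => by
    have h1 := h.1
    have h2 := h.2.1
    have h3 := h.2.2.le
    have := sum_length_chainFactors_le (s := p) (by omega) h.2.2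
    simp only [chainFactors, List.map_cons, List.sum_cons]
    omega

end Chain

/-! ### Products of unitaries over lists. -/

section Unitary

variable {A : Type*} [CStarAlgebra A]

theorem norm_mul_sub_mul_le {u u' v v' : A} (hu : ‖u‖ ≤ 1) (hv' : ‖v'‖ ≤ 1) :
    ‖u * v - u' * v'‖ ≤ ‖u - u'‖ + ‖v - v'‖ := by
  have e : u * v - u' * v' = (u - u') * v' + u * (v - v') := by noncomm_ring
  rw [e]
  have h1 : ‖(u - u') * v'‖ ≤ ‖u - u'‖ * 1 := norm_mul_le_of_le le_rfl hv'
  have h2 : ‖u * (v - v')‖ ≤ 1 * ‖v - v'‖ := norm_mul_le_of_le hu le_rfl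
  linarith [norm_add_le ((u - u') * v') (u * (v - v'))]

theorem list_prod_mem_unitary {ι : Type*} {U : ι → A} (hU : ∀ i, U i ∈ unitary A) (c : List ι) :
    (c.map U).prod ∈ unitary A :=
  list_prod_mem fun u hu => by
    obtain ⟨i, _, rfl⟩ := List.mem_map.1 hu
    exact hU i

theorem norm_prod_flatMap_sub_le {ι : Type*} {U : ι → A} (hU : ∀ i, U i ∈ unitary A)
    (f : ι → List ι) (err : ι → ℝ) : ∀ c : List ι,
    (∀ i ∈ c, ‖((f i).map U).prod - U i‖ ≤ err i) →
    ‖((c.flatMap f).map U).prod - (c.map U).prod‖ ≤ (c.map err).sum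
  | [], _ => by simp
  | i :: c, h => by
    rw [List.flatMap_cons, List.map_append, List.prod_append, List.map_cons, List.prod_cons,
      List.map_cons, List.sum_cons]
    refine (norm_mul_sub_mul_le (norm_le_one_of_mem_unitary (list_prod_mem_unitary hU _))
      (norm_le_one_of_mem_unitary (list_prod_mem_unitary hU _))).trans ?_
    exact add_le_add (h i List.mem_cons_self)
      (norm_prod_flatMap_sub_le hU f err c fun j hj => h j (List.mem_cons_of_mem _ hj))

theorem prod_map_star_reverse {ι : Type*} (U : ι → A) : ∀ c : List ι,
    (c.reverse.map fun i => star (U i)).prod = star (c.map U).prod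
  | [] => by simp
  | i :: c => by
    rw [List.reverse_cons, List.map_append, List.prod_append, prod_map_star_reverse U c,
      List.map_cons (f := U), List.prod_cons, star_mul]
    simp

end Unitary

/-! ### Boxes, their cross-sections and volumes. -/

section Blocks

open scoped Matrix.Norms.L2Operator

variable {D : ℕ}

namespace Block

/-- The volume of a box. -/
def vol (b : Block D) : ℕ := ∏ j, (b.hi j - b.lo j)

/-- The area of the cross-section of a box orthogonal to the axis `k`. -/
def area (b : Block D) (k : Fin D) : ℕ := ∏ j ∈ Finset.univ.erase k, (b.hi j - b.lo j)

/-- The cylinder over the cross-section of a box orthogonal to the axis `k`. -/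
def cylinder (L : ℕ) (b : Block D) (k : Fin D) : Finset (Site D L) :=
  Finset.univ.filter fun x => ∀ j, j ≠ k → b.lo j ≤ (x j : ℕ) ∧ (x j : ℕ) < b.hi j

theorem region_eq_slab (L : ℕ) (b : Block D) (k : Fin D) :
    b.region L = slab (b.cylinder L k) k (b.lo k) (b.hi k) := by
  ext x
  simp only [region, slab, cylinder, Finset.mem_filter, Finset.mem_univ, true_and]
  refine ⟨fun h => ⟨fun j _ => h j, h k⟩, fun h j => ?_⟩
  by_cases hj : j = k
  · subst hj; exact h.2
  · exact h.1 j hj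

theorem cylinder_restrict (L : ℕ) (b : Block D) (k : Fin D) (s : ℕ × ℕ) (back : Bool) :
    (b.restrict k s back).cylinder L k = b.cylinder L k := by
  refine Finset.filter_congr fun x _ => forall_congr' fun j => forall_congr' fun hj => ?_
  simp only [restrict]
  rw [Function.update_of_ne hj, Function.update_of_ne hj]

theorem region_restrict (L : ℕ) (b : Block D) (k : Fin D) (s : ℕ × ℕ) (back : Bool) :
    (b.restrict k s back).region L = slab (b.cylinder L k) k s.1 s.2 := by
  rw [region_eq_slab L _ k, cylinder_restrict]
  simp [restrict]

theorem area_restrict (b : Block D) (k : Fin D) (s : ℕ × ℕ) (back : Bool) :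
    (b.restrict k s back).area k = b.area k := by
  refine Finset.prod_congr rfl fun j hj => ?_
  have hj := Finset.ne_of_mem_erase hj
  simp [restrict, Function.update_of_ne hj]

theorem vol_eq (b : Block D) (k : Fin D) : b.vol = (b.hi k - b.lo k) * b.area k :=
  (Finset.mul_prod_erase _ _ (Finset.mem_univ k)).symm

theorem vol_restrict (b : Block D) (k : Fin D) (s : ℕ × ℕ) (back : Bool) :
    (b.restrict k s back).vol = (s.2 - s.1) * b.area k := by
  rw [vol_eq _ k, area_restrict]
  simp [restrict]

theorem card_cylinder_filter_le (L : ℕ) (b : Block D) (k : Fin D) (i : ℕ) :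
    ((b.cylinder L k).filter fun x => (x k : ℕ) = i).card ≤ b.area k := by
  set F : Fin D → Finset (Fin L) := fun j => if j = k then Finset.univ.filter (fun y => (y : ℕ) = i)
    else Finset.univ.filter fun y => b.lo j ≤ (y : ℕ) ∧ (y : ℕ) < b.hi j
  have hsub : ((b.cylinder L k).filter fun x => (x k : ℕ) = i) ⊆ Fintype.piFinset F := by
    intro x hx
    simp only [cylinder, Finset.mem_filter, Finset.mem_univ, true_and] at hx
    rw [Fintype.mem_piFinset]
    intro j
    by_cases hj : j = k
    · subst hj; simpa [F] using hx.2
    · simpa [F, hj] using hx.1 j hj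
  refine (Finset.card_le_card hsub).trans ?_
  rw [Fintype.card_piFinset, ← Finset.mul_prod_erase _ _ (Finset.mem_univ k), area]
  have hk : (F k).card ≤ 1 := by
    rw [Finset.card_le_one]
    intro y hy z hz
    simp only [F, if_true, Finset.mem_filter, Finset.mem_univ, true_and] at hy hz
    exact Fin.ext (hy.trans hz.symm)
  have hj : ∀ j ∈ Finset.univ.erase k, (F j).card ≤ b.hi j - b.lo j := by
    intro j hj
    have hj := Finset.ne_of_mem_erase hj
    have := Finset.card_le_card_of_injOn (s := F j) (t := Finset.Ico (b.lo j) (b.hi j))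
      (fun y : Fin L => (y : ℕ)) (fun y hy => by simpa [F, hj] using hy)
      (fun _ _ _ _ h => Fin.ext h)
    rwa [Nat.card_Ico] at this
  exact (Nat.mul_le_mul hk (Finset.prod_le_prod' hj)).trans_eq (one_mul _)

theorem sign_sq (b : Block D) : b.sign ^ 2 = 1 := by
  unfold sign; split_ifs <;> norm_num

theorem sign_restrict (b : Block D) (k : Fin D) (s : ℕ × ℕ) (back : Bool) :
    (b.restrict k s back).sign = b.sign * if back then -1 else 1 := by
  cases hb : b.backward <;> cases back <;> simp [sign, restrict, hb]

theorem length_cut (L : ℕ) (b : Block D) (k : Fin D) (c : List (ℕ × ℕ)) :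
    (b.cut L k c).length = 2 * c.length + 1 := by
  unfold cut
  split_ifs <;> simp [length_chainFactors]

theorem mem_cut {L : ℕ} {b b' : Block D} {k : Fin D} {c : List (ℕ × ℕ)} (h : b' ∈ b.cut L k c) :
    ∃ s back, b' = b.restrict k s back := by
  have h' : b' ∈ (chainFactors L 0 c).map fun s => b.restrict k s.1 s.2 := by
    unfold cut at h
    split_ifs at h
    · exact List.mem_reverse.1 h
    · exact h
  obtain ⟨s, _, rfl⟩ := List.mem_map.1 h'
  exact ⟨s.1, s.2, rfl⟩

/-- The box is not restricted along the axis `k`. -/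
def FullAlong (L : ℕ) (b : Block D) (k : Fin D) : Prop := b.lo k = 0 ∧ b.hi k = L

theorem FullAlong.restrict {L : ℕ} {b : Block D} {k j : Fin D} (h : b.FullAlong L j)
    (hj : j ≠ k) (s : ℕ × ℕ) (back : Bool) : (b.restrict k s back).FullAlong L j := by
  simpa [FullAlong, Block.restrict, Function.update_of_ne hj] using h

theorem FullAlong.vol_eq {L : ℕ} {b : Block D} {k : Fin D} (h : b.FullAlong L k) :
    b.vol = L * b.area k := by
  rw [b.vol_eq k, h.1, h.2, Nat.sub_zero]

theorem sum_vol_cut_le {L l : ℕ} {b : Block D} {k : Fin D} {c : List (ℕ × ℕ)}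
    (hc : OverlapsOK L l 0 c) (hb : b.FullAlong L k) :
    ((b.cut L k c).map vol).sum ≤ 3 * b.vol := by
  have h1 : ((b.cut L k c).map vol).sum
      = (((chainFactors L 0 c).map fun s => b.restrict k s.1 s.2).map vol).sum := by
    unfold cut
    split_ifs
    · rw [List.map_reverse, List.sum_reverse]
    · rfl
  rw [h1, List.map_map]
  have h2 : (vol ∘ fun s : (ℕ × ℕ) × Bool => b.restrict k s.1 s.2)
      = fun s => (s.1.2 - s.1.1) * b.area k := funext fun s => b.vol_restrict k s.1 s.2
  rw [h2, List.sum_map_mul_right, hb.vol_eq, ← mul_assoc]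
  refine Nat.mul_le_mul_right _ ?_
  simpa using sum_length_chainFactors_le le_rfl hc

end Block

/-! ### Summing the errors of all cuts. -/

section Evolution

variable {L q : ℕ} (H : LocalHamiltonian D L q)

/-- The evolution operator of a block. -/
noncomputable def blockOp (t : ℝ) (b : Block D) : Op D L q :=
  evolOp (H.onRegion (b.region L)) (b.sign * t)

theorem blockOp_mem_unitary (t : ℝ) (b : Block D) : blockOp H t b ∈ unitary (Op D L q) :=
  evol_mem_unitary (H.isHermitian_onRegion _) _

/-- The error of a single cut, per unit of area of the cross-section. -/
noncomputable def cutError (D l : ℕ) (t : ℝ) : ℝ :=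
  degBound D * (Real.exp (1 - l) * Real.exp (lrRate D * t)) * t

theorem cutError_nonneg (D l : ℕ) {t : ℝ} (ht : 0 ≤ t) : 0 ≤ cutError D l t := by
  unfold cutError; positivity

/-- The evolution operator of a factor of a chain of slabs. -/
noncomputable def factorOp (Q : Finset (Site D L)) (k : Fin D) (t : ℝ) (f : (ℕ × ℕ) × Bool) :
    Op D L q :=
  evolOp (H.onRegion (slab Q k f.1.1 f.1.2)) ((if f.2 then -1 else 1) * t)

theorem factorOp_mem_unitary (Q : Finset (Site D L)) (k : Fin D) (t : ℝ)
    (f : (ℕ × ℕ) × Bool) : factorOp H Q k t f ∈ unitary (Op D L q) :=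
  evol_mem_unitary (H.isHermitian_onRegion _) _

/-- Induction on the cuts. The remaining chain stands to the right of two unitaries, so its error
passes through unchanged and each cut adds one unit. Keeping `s₀` separate from `s` records that the
next overlap begins after the previous one ends. -/
theorem norm_prod_chainFactors_sub_le {l : ℕ} (hl : 1 ≤ l) {Q : Finset (Site D L)} {k : Fin D}
    {a : ℕ} (ha : ∀ i : ℕ, (Q.filter fun x => (x k : ℕ) = i).card ≤ a) {t : ℝ} (ht : 0 ≤ t) :
    ∀ {s s₀ : ℕ} {c : List (ℕ × ℕ)}, s ≤ s₀ → OverlapsOK L l s₀ c →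
    ‖((chainFactors L s c).map (factorOp H Q k t)).prod - evolOp (H.onRegion (slab Q k s L)) t‖
      ≤ c.length * (a * cutError D l t)
  | s, s₀, [], hs, h => by simp [chainFactors, factorOp]
  | s, s₀, (p, e) :: c, hs, h => by
    have h1 := h.1
    have h2 := h.2.1
    have h3 := h.2.2.le
    have ih := norm_prod_chainFactors_sub_le hl ha ht (s := p) (by omega) h.2.2
    have hcut := H.norm_cut_sub_le (k := k) (hs.trans h1) (show p < e by omega) h3 ha ht
    -- The overlap $[p,e)$ has at least $l$ sites; this is where the decay in $l$ enters.
    have hexp : Real.exp ((p : ℝ) + 1 - e) ≤ Real.exp (1 - l) := by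
      rw [Real.exp_le_exp]
      have : (p : ℝ) + l ≤ e := by exact_mod_cast h2
      linarith
    have hcut' : ‖evolOp (H.onRegion (slab Q k s e)) t * (evolOp (H.onRegion (slab Q k p e)) (-t)
        * evolOp (H.onRegion (slab Q k p L)) t) - evolOp (H.onRegion (slab Q k s L)) t‖
        ≤ a * cutError D l t := by
      refine hcut.trans ?_
      rw [cutError, ← mul_assoc, ← mul_assoc, ← mul_assoc, ← mul_assoc]
      gcongr
    rw [chainFactors, List.map_cons, List.map_cons, List.prod_cons, List.prod_cons]
    have e1 : factorOp H Q k t ((s, e), false) = evolOp (H.onRegion (slab Q k s e)) t := by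
      simp [factorOp]
    have e2 : factorOp H Q k t ((p, e), true) = evolOp (H.onRegion (slab Q k p e)) (-t) := by
      simp [factorOp]
    have hu1 := factorOp_mem_unitary H Q k t ((s, e), false)
    have hu2 := factorOp_mem_unitary H Q k t ((p, e), true)
    have hdiff : ‖factorOp H Q k t ((s, e), false) * (factorOp H Q k t ((p, e), true) *
          ((chainFactors L p c).map (factorOp H Q k t)).prod)
        - factorOp H Q k t ((s, e), false) * (factorOp H Q k t ((p, e), true) *
          evolOp (H.onRegion (slab Q k p L)) t)‖ ≤ c.length * (a * cutError D l t) := by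
      rw [← mul_sub, ← mul_sub, CStarRing.norm_mem_unitary_mul _ hu1,
        CStarRing.norm_mem_unitary_mul _ hu2]
      exact ih
    rw [← e1, ← e2] at hcut'
    have := norm_sub_le_norm_sub_add_norm_sub
      (factorOp H Q k t ((s, e), false) * (factorOp H Q k t ((p, e), true) *
          ((chainFactors L p c).map (factorOp H Q k t)).prod))
      (factorOp H Q k t ((s, e), false) * (factorOp H Q k t ((p, e), true) *
          evolOp (H.onRegion (slab Q k p L)) t)) (evolOp (H.onRegion (slab Q k s L)) t)
    rw [List.length_cons, Nat.cast_succ]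
    linarith

/-- For a backward block the reversed list of reversed factors is the adjoint of the forward
product, so the error is the same. -/
theorem norm_prod_cut_sub_le {l : ℕ} (hl : 1 ≤ l) {b : Block D} {k : Fin D}
    {c : List (ℕ × ℕ)} (hc : OverlapsOK L l 0 c) (hb : b.FullAlong L k) {t : ℝ} (ht : 0 ≤ t) :
    ‖((b.cut L k c).map (blockOp H t)).prod - blockOp H t b‖
      ≤ c.length * (b.area k * cutError D l t) := by
  have key := norm_prod_chainFactors_sub_le H hl (b.card_cylinder_filter_le L k) ht le_rfl hc
  have hreg : b.region L = slab (b.cylinder L k) k 0 L := by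
    rw [b.region_eq_slab L k, hb.1, hb.2]
  cases hback : b.backward
  · have hs : b.sign = 1 := by simp [Block.sign, hback]
    have h1 : (b.cut L k c).map (blockOp H t)
        = (chainFactors L 0 c).map (factorOp H (b.cylinder L k) k t) := by
      rw [Block.cut, hback, if_neg Bool.false_ne_true, List.map_map]
      refine List.map_congr_left fun f _ => ?_
      simp [blockOp, factorOp, Block.region_restrict, Block.sign_restrict, hs]
    have h2 : blockOp H t b = evolOp (H.onRegion (slab (b.cylinder L k) k 0 L)) t := by
      simp [blockOp, hreg, hs]
    rw [h1, h2]
    exact key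
  · have hs : b.sign = -1 := by simp [Block.sign, hback]
    have h1 : (b.cut L k c).map (blockOp H t)
        = (chainFactors L 0 c).reverse.map
          fun f => star (factorOp H (b.cylinder L k) k t f) := by
      rw [Block.cut, hback, if_pos rfl, ← List.map_reverse, List.map_map]
      refine List.map_congr_left fun f _ => ?_
      have : star (factorOp H (b.cylinder L k) k t f) = _ :=
        star_evol (H.isHermitian_onRegion _) _
      rw [this]
      cases hf : f.2 <;>
        simp [blockOp, Block.region_restrict, Block.sign_restrict, hs, evolOp_eq_evol, hf]
    have h2 : blockOp H t b = star (evolOp (H.onRegion (slab (b.cylinder L k) k 0 L)) t) := by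
      have : star (evolOp (H.onRegion (slab (b.cylinder L k) k 0 L)) t) = _ :=
        star_evol (H.isHermitian_onRegion _) _
      rw [this]
      simp [blockOp, hreg, hs, evolOp_eq_evol]
    rw [h1, h2, prod_map_star_reverse, ← star_sub, norm_star]
    exact key

/-- The blocks after cutting the blocks `bs` along the axes in `ks`. -/
def cutAlong (L : ℕ) (cuts : Fin D → Block D → List (ℕ × ℕ)) (ks : List (Fin D))
    (bs : List (Block D)) : List (Block D) :=
  ks.foldl (fun bs k => bs.flatMap fun b => b.cut L k (cuts k b)) bs

theorem lrBlocks_eq (L : ℕ) (cuts : Fin D → Block D → List (ℕ × ℕ)) :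
    lrBlocks L cuts = cutAlong L cuts (List.finRange D) [Block.full D L] := rfl

variable {cuts : Fin D → Block D → List (ℕ × ℕ)}

theorem length_cutAlong_pos : ∀ (ks : List (Fin D)) {bs : List (Block D)}, 0 < bs.length →
    0 < (cutAlong L cuts ks bs).length
  | [], _, h => h
  | k :: ks, b :: bs, _ => by
    refine length_cutAlong_pos ks ?_
    simp only [List.flatMap_cons, List.length_append, Block.length_cut]
    omega

theorem length_flatMap_cut_le {l : ℕ} (hl : 1 ≤ l) (hcuts : ∀ k b, OverlapsOK L l 0 (cuts k b))
    (k : Fin D) : ∀ bs : List (Block D),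
    ((bs.flatMap fun b => b.cut L k (cuts k b)).length : ℝ) ≤ (2 * ((L : ℝ) / l) + 1) * bs.length
  | [] => by simp
  | b :: bs => by
    have ih := length_flatMap_cut_le hl hcuts k bs
    have hl0 : (0 : ℝ) < l := by exact_mod_cast hl
    have h1 : ((cuts k b).length : ℝ) ≤ (L : ℝ) / l := by
      rw [le_div_iff₀ hl0]
      have := (hcuts k b).mul_length_le
      rw [add_zero, mul_comm] at this
      exact_mod_cast this
    rw [List.flatMap_cons, List.length_append, Block.length_cut, List.length_cons]
    push_cast
    linarith

theorem length_cutAlong_le {l : ℕ} (hl : 1 ≤ l) (hcuts : ∀ k b, OverlapsOK L l 0 (cuts k b)) :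
    ∀ (ks : List (Fin D)) (bs : List (Block D)),
    ((cutAlong L cuts ks bs).length : ℝ) ≤ (2 * ((L : ℝ) / l) + 1) ^ ks.length * bs.length
  | [], bs => by simp [cutAlong]
  | k :: ks, bs => by
    refine (length_cutAlong_le hl hcuts ks _).trans ?_
    rw [List.length_cons, pow_succ, mul_assoc]
    exact mul_le_mul_of_nonneg_left (length_flatMap_cut_le hl hcuts k bs) (by positivity)

theorem sum_vol_flatMap_cut_le {l : ℕ} (hcuts : ∀ k b, OverlapsOK L l 0 (cuts k b))
    (k : Fin D) : ∀ bs : List (Block D), (∀ b ∈ bs, b.FullAlong L k) →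
    ((bs.flatMap fun b => b.cut L k (cuts k b)).map Block.vol).sum ≤ 3 * (bs.map Block.vol).sum
  | [], _ => by simp
  | b :: bs, h => by
    have ih := sum_vol_flatMap_cut_le hcuts k bs fun b' hb' => h b' (List.mem_cons_of_mem _ hb')
    have h1 := Block.sum_vol_cut_le (hcuts k b) (h b List.mem_cons_self)
    rw [List.flatMap_cons, List.map_append, List.sum_append, List.map_cons, List.sum_cons]
    omega

/-- Volume is the bookkeeping quantity: a round costs at most the total volume present times
`cutError D l t / l`, and at most triples that volume. As each axis is cut only once, blocks still
have full length $L$ along the axes to come. -/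
theorem norm_prod_cutAlong_sub_le {l : ℕ} (hl : 1 ≤ l)
    (hcuts : ∀ k b, OverlapsOK L l 0 (cuts k b)) {t : ℝ} (ht : 0 ≤ t) :
    ∀ (ks : List (Fin D)), ks.Nodup → ∀ bs : List (Block D),
    (∀ b ∈ bs, ∀ k ∈ ks, b.FullAlong L k) →
    ‖((cutAlong L cuts ks bs).map (blockOp H t)).prod - (bs.map (blockOp H t)).prod‖
      ≤ ks.length * 3 ^ ks.length * ((bs.map Block.vol).sum * cutError D l t / l)
  | [], _, bs, _ => by simp [cutAlong]
  | k :: ks, hks, bs, hbs => by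
    have hl0 : (0 : ℝ) < l := by exact_mod_cast hl
    have hE := cutError_nonneg D l ht
    rw [List.nodup_cons] at hks
    set bs' := bs.flatMap fun b => b.cut L k (cuts k b)
    have hk : ∀ b ∈ bs, b.FullAlong L k := fun b hb => hbs b hb k List.mem_cons_self
    have ih := norm_prod_cutAlong_sub_le hl hcuts ht ks hks.2 bs' (by
      intro b hb j hj
      obtain ⟨b₀, hb₀, hb⟩ := List.mem_flatMap.1 hb
      obtain ⟨s, back, rfl⟩ := Block.mem_cut hb
      refine (hbs b₀ hb₀ j (List.mem_cons_of_mem _ hj)).restrict ?_ s back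
      rintro rfl
      exact hks.1 hj)
    -- There are at most $L/l$ cuts, each costing the cross-section; full length along `k` turns $L$
    -- times the cross-section into the volume.
    have hstep := norm_prod_flatMap_sub_le (blockOp_mem_unitary H t)
      (fun b => b.cut L k (cuts k b)) (fun b => (b.vol : ℝ) * (cutError D l t / l)) bs
      (fun b hb => by
        refine (norm_prod_cut_sub_le H hl (hcuts k b) (hk b hb) ht).trans ?_
        rw [(hk b hb).vol_eq, ← mul_assoc, mul_div_assoc', le_div_iff₀ hl0, mul_right_comm]
        refine mul_le_mul_of_nonneg_right ?_ hE
        have h1 : l * (cuts k b).length ≤ L := (hcuts k b).mul_length_le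
        have h2 := Nat.mul_le_mul_right (b.area k) h1
        have h3 : ((l * (cuts k b).length * b.area k : ℕ) : ℝ) ≤ ((L * b.area k : ℕ) : ℝ) :=
          Nat.cast_le.2 h2
        push_cast at h3 ⊢
        linarith)
    have hvol : ((bs'.map Block.vol).sum : ℝ) ≤ 3 * (bs.map Block.vol).sum := by
      exact_mod_cast sum_vol_flatMap_cut_le hcuts k bs hk
    have hsum : (bs.map fun b => (b.vol : ℝ) * (cutError D l t / l)).sum
        = (bs.map Block.vol).sum * cutError D l t / l := by
      rw [List.sum_map_mul_right, Nat.cast_list_sum, List.map_map, mul_div_assoc]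
      rfl
    rw [hsum] at hstep
    have htri := norm_sub_le_norm_sub_add_norm_sub
      ((cutAlong L cuts (k :: ks) bs).map (blockOp H t)).prod (bs'.map (blockOp H t)).prod
      (bs.map (blockOp H t)).prod
    refine htri.trans ((add_le_add ih hstep).trans ?_)
    set V : ℝ := ((bs.map Block.vol).sum : ℝ)
    have hV : 0 ≤ V := Nat.cast_nonneg _
    have h1 : ((bs'.map Block.vol).sum : ℝ) * cutError D l t / l
        ≤ 3 * (V * cutError D l t / l) := by
      rw [mul_div_assoc, mul_div_assoc, ← mul_assoc]
      exact mul_le_mul_of_nonneg_right hvol (by positivity)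
    have h2 : 0 ≤ V * cutError D l t / l := by positivity
    -- With $n$ axes left after this one, the recursion closes by $3\cdot n3^n+1\le (n+1)3^{n+1}$.
    have h3 : (1 : ℝ) ≤ 3 ^ (ks.length + 1) := one_le_pow₀ (by norm_num)
    have h4 := mul_le_mul_of_nonneg_left h1
      (show (0 : ℝ) ≤ ks.length * 3 ^ ks.length by positivity)
    have h5 := mul_le_mul_of_nonneg_right h3 h2
    rw [List.length_cons, Nat.cast_succ, pow_succ] at *
    linarith

theorem norm_prod_lrBlocks_sub_le {l : ℕ} (hl : 1 ≤ l)
    (hcuts : ∀ k b, OverlapsOK L l 0 (cuts k b)) {t : ℝ} (ht : 0 ≤ t) :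
    ‖((lrBlocks L cuts).map (blockOp H t)).prod - evolOp H.total t‖
      ≤ D * 3 ^ D * ((L : ℝ) ^ D * cutError D l t / l) := by
  have key := norm_prod_cutAlong_sub_le H hl hcuts ht (List.finRange D) (List.nodup_finRange D)
    [Block.full D L] (by
      intro b hb k _
      rw [List.mem_singleton] at hb
      subst hb
      exact ⟨rfl, rfl⟩)
  have hreg : (Block.full D L).region L = Finset.univ := by
    ext x
    simp [Block.region, Block.full]
  have htot : blockOp H t (Block.full D L) = evolOp H.total t := by
    rw [blockOp, hreg]
    simp [Block.sign, Block.full, LocalHamiltonian.onRegion, LocalHamiltonian.total]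
  have hvol : (Block.full D L).vol = L ^ D := by simp [Block.vol, Block.full]
  rw [← lrBlocks_eq, List.length_finRange] at key
  simpa [htot, hvol] using key

end Evolution

end Blocks

end LocalComposite

/-! ### Assembly of the two errors. -/

namespace LocalComposite

open scoped Matrix.Norms.L2Operator

/-- The Lieb-Robinson error of the block decomposition. -/
theorem diamondLE_lrBlocks_sub {D L q l : ℕ} (hl : 1 ≤ l)
    {cuts : Fin D → Block D → List (ℕ × ℕ)} (hcuts : ∀ k b, OverlapsOK L l 0 (cuts k b))
    (H : LocalHamiltonian D L q) {t : ℝ} (ht : 0 ≤ t) :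
    DiamondLE ((List.ofFn fun i => evolChannel
        (H.onRegion (((lrBlocks L cuts).get i).region L))
        (((lrBlocks L cuts).get i).sign * t)).prod - evolChannel H.total t)
      (2 * (D * 3 ^ D * ((L : ℝ) ^ D * cutError D l t / l))) := by
  have h1 : (List.ofFn fun i => evolChannel (H.onRegion (((lrBlocks L cuts).get i).region L))
      (((lrBlocks L cuts).get i).sign * t)).prod
      = conjChannel ((lrBlocks L cuts).map (blockOp H t)).prod := by
    rw [conjChannel_prod, List.map_map]
    congr 1
    conv_rhs => rw [← List.ofFn_get (lrBlocks L cuts), List.map_ofFn]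
    rfl
  have hH : H.total.IsHermitian := H.isHermitian_sum Finset.univ
  rw [h1]
  refine (DiamondLE.conjChannel_sub (norm_le_one_of_mem_unitary
    (list_prod_mem_unitary (blockOp_mem_unitary H t) _)) (norm_evolOp_le hH t)).mono ?_
  exact mul_le_mul_of_nonneg_left (norm_prod_lrBlocks_sub_le H hl hcuts ht) zero_le_two

theorem cutError_le {D l : ℕ} {t T : ℝ} (ht : 0 ≤ t) (htT : t ≤ T) :
    cutError D l t
      ≤ degBound D * (Real.exp 1 * Real.exp (lrRate D * T)) * T * Real.exp (-1 * l) := by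
  have h := lrRate_nonneg D
  have e : Real.exp (1 - l) = Real.exp 1 * Real.exp (-1 * l) := by
    rw [← Real.exp_add]; congr 1; ring
  have hT : 0 ≤ T := ht.trans htT
  calc cutError D l t
      ≤ degBound D * (Real.exp (1 - l) * Real.exp (lrRate D * T)) * T := by
        unfold cutError; gcongr
    _ = _ := by rw [e]; ring

end LocalComposite

theorem mainTheorem4 (D : ℕ) :
    ∃ μ : ℝ, 0 < μ ∧ ∀ T : ℝ, ∃ C : ℝ, 0 < C ∧
      ∀ (q L l : ℕ) (_ : 1 ≤ q) (_ : 1 ≤ l)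
        (cuts : Fin D → Block D → List (ℕ × ℕ))
        (_ : ∀ k b, OverlapsOK L l 0 (cuts k b))
        (H : LocalHamiltonian D L q)
        (P : ∀ i : Fin (lrBlocks L cuts).length, Partition H (((lrBlocks L cuts).get i).region L))
        (t : ℝ) (_ : 0 ≤ t) (_ : t ≤ T) (r : ℕ) (_ : 1 ≤ r),
        let m : ℕ := (lrBlocks L cuts).length
        let b : Fin m → Block D := (lrBlocks L cuts).get
        -- the exact evolution on the block `Y_i`, backwards in time if the construction says so
        let UY : Fin m → Module.End ℂ (Op D L q) := fun i =>
          evolChannel (H.onRegion ((b i).region L)) ((b i).sign * t)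
        -- the composite channel on the block `Y_i`, iterated `r` times
        let XYr : Fin m → Module.End ℂ (Op D L q) := fun i =>
          (P i).compositeChannel ((b i).sign * (t / r)) ^ r
        let εLR : ℝ := diamondNorm ((List.ofFn UY).prod - evolChannel H.total t)
        0 < m ∧ (m : ℝ) ≤ (2 * ((L : ℝ) / l) + 1) ^ D ∧
        diamondNorm ((List.ofFn XYr).prod - evolChannel H.total t)
          ≤ m * (⨆ i, diamondNorm (XYr i - UY i)) + εLR ∧
        m * (⨆ i, diamondNorm (XYr i - UY i)) + εLR
          ≤ m * (⨆ i, (P i).errorBound t r) +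
            C * (Real.exp (-μ * l) * (D * (L : ℝ) ^ D / l)) ∧
        εLR ≤ C * (Real.exp (-μ * l) * (D * (L : ℝ) ^ D / l)) := by
  set c : ℝ → ℝ := fun T => degBound D * (Real.exp 1 * Real.exp (lrRate D * T)) * T
  -- The rate 1 is that of the weight $e^{\text{height}}$. In the constant, 2 comes from passing to
  -- channels and $3^D$ from the growth of volume; the absolute value and the summand 1 keep it
  -- positive for every `T`.
  refine ⟨1, one_pos, fun T => ⟨2 * 3 ^ D * |c T| + 1, by positivity, ?_⟩⟩
  intro q L l _ hl cuts hcuts H P t ht htT r hr m b UY XYr εLR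
  have hm : 0 < m := by
    change 0 < (lrBlocks L cuts).length
    rw [lrBlocks_eq]
    exact length_cutAlong_pos _ (by simp)
  have hmle : (m : ℝ) ≤ (2 * ((L : ℝ) / l) + 1) ^ D := by
    have := length_cutAlong_le hl hcuts (List.finRange D) [Block.full D L]
    rw [← lrBlocks_eq] at this
    simpa using this
  have hl0 : (0 : ℝ) < l := by exact_mod_cast hl
  have hLR := diamondLE_lrBlocks_sub hl hcuts H ht
  have hε : εLR ≤ (2 * 3 ^ D * |c T| + 1) * (Real.exp (-1 * l) * (D * (L : ℝ) ^ D / l)) := by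
    have hE := cutError_nonneg D l ht
    refine (hLR.diamondNorm_le (by positivity)).trans ?_
    have h1 : cutError D l t ≤ |c T| * Real.exp (-1 * l) :=
      (cutError_le ht htT).trans (mul_le_mul_of_nonneg_right (le_abs_self _) (Real.exp_pos _).le)
    calc 2 * (D * 3 ^ D * ((L : ℝ) ^ D * cutError D l t / l))
        ≤ 2 * (D * 3 ^ D * ((L : ℝ) ^ D * (|c T| * Real.exp (-1 * l)) / l)) := by gcongr
      _ = (2 * 3 ^ D * |c T|) * (Real.exp (-1 * l) * (D * (L : ℝ) ^ D / l)) := by ring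
      _ ≤ _ := mul_le_mul_of_nonneg_right (by linarith) (by positivity)
  have hX : ∀ i, DiamondLE (XYr i) 1 := fun i =>
    ((P i).diamondLE_compositeChannel ((b i).sign * (t / r))).pow r
  have hU : ∀ i, DiamondLE (UY i) 1 := fun i =>
    diamondLE_evolChannel (H.isHermitian_onRegion ((b i).region L)) ((b i).sign * t)
  have hXU : ∀ i, DiamondLE (XYr i - UY i) ((P i).errorBound t r) := fun i =>
    (P i).diamondLE_compositeChannel_pow_sub (b i).sign_sq t hr
  have hbdd : BddAbove (Set.range fun i => diamondNorm (XYr i - UY i)) :=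
    (Set.finite_range _).bddAbove
  have hbdd' : BddAbove (Set.range fun i => (P i).errorBound t r) :=
    (Set.finite_range _).bddAbove
  have hsup : 0 ≤ ⨆ i, diamondNorm (XYr i - UY i) :=
    Real.iSup_nonneg fun i => DiamondLE.diamondNorm_nonneg _
  have hfirst : diamondNorm ((List.ofFn XYr).prod - evolChannel H.total t)
      ≤ m * (⨆ i, diamondNorm (XYr i - UY i)) + εLR := by
    -- `self` replaces the explicit bound of each block by its diamond norm, so that the largest
    -- block error appears in the first inequality.
    have h1 := DiamondLE.prod_ofFn_sub hX hU hsup fun i =>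
      (hXU i).self.mono (le_ciSup hbdd i)
    have h2 := h1.add hLR.self
    rw [sub_add_sub_cancel] at h2
    exact h2.diamondNorm_le
      (add_nonneg (mul_nonneg m.cast_nonneg hsup) (DiamondLE.diamondNorm_nonneg _))
  refine ⟨hm, hmle, hfirst, add_le_add (mul_le_mul_of_nonneg_left ?_ m.cast_nonneg) hε, hε⟩
  exact ciSup_mono hbdd' fun i => (hXU i).diamondNorm_le ((P i).errorBound_nonneg t r)
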